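/- Proposition (Closure under products). Let $F$ be Thompson's group of orientation-preserving piecewise linear homeomorphisms of $[0,1]$ with finitely many breakpoints, all dyadic rationals, and with all slopes powers of $2$. Every element of $F$ is represented by a unique nonempty reduced pair $(S,T)$ of finite rooted binary trees with the same number of carets: it maps the dyadic interval of the $i$-th leaf of $S$ affinely onto that of the $i$-th leaf of $T$, for all $i$. (The pair is reduced if it consists of two single carets, which represents the identity, or if there is no $i$ such that leaves $i$ and $i+1$ are the two children of one caret in both $S$ and $T$.) The size of a reduced pair is its number of carets in either tree. For $k\ge 1$ let $\mathrm{Sph}_k(n)$ be the finite set of unordered $k$-tuples (repetitions allowed) of nonempty reduced tree pairs in which the maximal size of a component is $n$. For a group $H$ let $T_H$ be the set of unordered $k$-tuples which generate a subgroup of $F$ isomorphic to $H$. We say that (the isomorphism class of) $H$ lies in $\mathrm{Spec}^{\max}_k(F)$ if $T_H$ has positive density in the sense that $$\liminf_{n\to\infty}\frac{|T_H\cap \mathrm{Sph}_k(n)|}{|\mathrm{Sph}_k(n)|}>0 .$$ For a group $H$ let $H\wr\mathbb Z$ be the restricted wreath product $\left(\bigoplus_{\mathbb Z}H\right)\rtimes\mathbb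 Z$. Then: 1. If $k\ge 1$ and $H\in\mathrm{Spec}^{\max}_k(F)$, then $H\times\mathbb Z$ and $H\wr\mathbb Z$ lie in $\mathrm{Spec}^{\max}_{k+1}(F)$. 2. For every $l\ge 1$ the $l$-fold iterated wreath product $(\cdots((\mathbb Z\wr\mathbb Z)\wr\mathbb Z)\cdots)\wr\mathbb Z$ ($l$ factors $\mathbb Z$) lies in $\mathrm{Spec}^{\max}_l(F)$. 3. If $l\ge 1$ and $H\in \mathrm{Spec}^{\max}_k(F)$ for all $k\ge l$, then $H\times\mathbb Z$ and $H\wr\mathbb Z$ lie in $\mathrm{Spec}^{\max}_k(F)$ for all $k\ge l+1$. 4. For $n\ge 1$, $m\ge 0$ and all $k\ge 2n+m$, the group $F^n\times\mathbb Z^m$ lies in $\mathrm{Spec}^{\max}_k(F)$. 5. For $n\ge 1$ and all $k\ge 2n+1$, the group $F^n\wr\mathbb Z$ lies in $\mathrm{Spec}^{\max}_k(F)$. -/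

import Mathlib

open Filter Topology

namespace ThompsonSpectrum

/-! ### Thompson's group as a group of piecewise linear homeomorphisms -/

/-- A dyadic rational number, as a real number. -/
def IsDyadic (x : ℝ) : Prop := ∃ (m : ℤ) (n : ℕ), x = m / 2 ^ n

/-- An increasing bijection `f` of `[0,1]` is dyadic piecewise linear if there is a finite set `B`
of dyadic rationals (containing all breakpoints) such that on every interval `[a,b] ⊆ [0,1]` with no
point of `B` in its interior `f` is affine and its slope is an integral power of two. -/
def IsDyadicPL (f : unitInterval ≃o unitInterval) : Prop :=
  ∃ B : Finset ℝ, (∀ c ∈ B, IsDyadic c) ∧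
    ∀ a b : unitInterval, a < b → (∀ c ∈ B, ¬ ((a : ℝ) < c ∧ c < (b : ℝ))) →
      ∃ k : ℤ, ∀ x : unitInterval, a ≤ x → x ≤ b →
        (f x : ℝ) = (f a : ℝ) + (2 : ℝ) ^ k * ((x : ℝ) - (a : ℝ))

theorem isDyadic_int (m : ℤ) : IsDyadic (m : ℝ) := ⟨m, 0, by simp⟩

theorem IsDyadic.add {x y : ℝ} (hx : IsDyadic x) (hy : IsDyadic y) : IsDyadic (x + y) := by
  obtain ⟨m, n, rfl⟩ := hx
  obtain ⟨p, q, rfl⟩ := hy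
  refine ⟨m * 2 ^ q + p * 2 ^ n, n + q, ?_⟩
  push_cast
  rw [pow_add]
  field_simp

theorem IsDyadic.neg {x : ℝ} (hx : IsDyadic x) : IsDyadic (-x) := by
  obtain ⟨m, n, rfl⟩ := hx
  exact ⟨-m, n, by push_cast; ring⟩

theorem IsDyadic.sub {x y : ℝ} (hx : IsDyadic x) (hy : IsDyadic y) : IsDyadic (x - y) := by
  rw [sub_eq_add_neg]
  exact hx.add hy.neg

theorem IsDyadic.mul {x y : ℝ} (hx : IsDyadic x) (hy : IsDyadic y) : IsDyadic (x * y) := by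
  obtain ⟨m, n, rfl⟩ := hx
  obtain ⟨p, q, rfl⟩ := hy
  refine ⟨m * p, n + q, ?_⟩
  push_cast
  rw [pow_add]
  field_simp

theorem isDyadic_two_zpow (k : ℤ) : IsDyadic ((2 : ℝ) ^ k) := by
  obtain ⟨n, rfl | rfl⟩ := k.eq_nat_or_neg
  · exact ⟨2 ^ n, 0, by simp⟩
  · exact ⟨1, n, by simp⟩

theorem IsDyadicPL.isDyadic_apply {f : unitInterval ≃o unitInterval} (hf : IsDyadicPL f)
    (x : unitInterval) (hx : IsDyadic (x : ℝ)) : IsDyadic (f x : ℝ) := by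
  classical
  obtain ⟨B, hB, h⟩ := hf
  have f0 : f 0 = 0 := f.map_bot
  suffices H : ∀ (n : ℕ) (x : unitInterval), IsDyadic (x : ℝ) →
      (B.filter (fun c => 0 < c ∧ c < (x : ℝ))).card = n → IsDyadic (f x : ℝ) from
    H _ x hx rfl
  intro n
  induction n using Nat.strong_induction_on with
  | _ n ih =>
    intro x hx hn
    rcases eq_or_lt_of_le (show (0 : unitInterval) ≤ x from x.2.1) with h0 | h0
    · rw [← h0, f0]
      exact ⟨0, 0, by simp⟩
    set S := B.filter (fun c => 0 < c ∧ c < (x : ℝ)) with hS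
    rcases S.eq_empty_or_nonempty with hE | hE
    · obtain ⟨k, hk⟩ := h 0 x h0 (fun c hc hcc => by
        have : c ∈ S := Finset.mem_filter.2 ⟨hc, by simpa using hcc⟩
        simp [hE] at this)
      rw [hk x h0.le le_rfl, f0]
      simpa using (isDyadic_two_zpow k).mul hx
    · have hm := S.max'_mem hE
      set b := S.max' hE with hb
      obtain ⟨hbB, hb0, hbx⟩ := Finset.mem_filter.1 hm
      let b' : unitInterval := ⟨b, hb0.le, hbx.le.trans x.2.2⟩
      have hfb : IsDyadic (f b' : ℝ) := by
        refine ih _ ?_ b' (hB b hbB) rfl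
        rw [← hn]
        refine Finset.card_lt_card ⟨fun c hc => ?_, fun hsub => ?_⟩
        · obtain ⟨h1, h2, h3⟩ := Finset.mem_filter.1 hc
          exact Finset.mem_filter.2 ⟨h1, h2, lt_trans h3 hbx⟩
        · exact lt_irrefl _ (Finset.mem_filter.1 (hsub hm)).2.2
      obtain ⟨k, hk⟩ := h b' x hbx (fun c hc hcc => by
        have hcS : c ∈ S := Finset.mem_filter.2 ⟨hc, lt_trans hb0 hcc.1, hcc.2⟩
        exact absurd (S.le_max' c hcS) (not_le.2 hcc.1))
      rw [hk x (show b' ≤ x from hbx.le) le_rfl]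
      exact hfb.add ((isDyadic_two_zpow k).mul (hx.sub (hB b hbB)))

theorem IsDyadicPL.inv {f : unitInterval ≃o unitInterval} (hf : IsDyadicPL f) :
    IsDyadicPL f⁻¹ := by
  classical
  have key := hf.isDyadic_apply
  obtain ⟨B, hB, h⟩ := hf
  refine ⟨B.image (fun c => (f (Set.projIcc 0 1 zero_le_one c) : ℝ)), ?_, ?_⟩
  · intro c hc
    obtain ⟨d, hd, rfl⟩ := Finset.mem_image.1 hc
    apply key
    rw [Set.coe_projIcc]
    rcases max_choice (0 : ℝ) (min 1 d) with h1 | h1 <;> rw [h1]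
    · exact ⟨0, 0, by simp⟩
    · rcases min_choice (1 : ℝ) d with h2 | h2 <;> rw [h2]
      · exact ⟨1, 0, by simp⟩
      · exact hB d hd
  · intro a b hab hno
    obtain ⟨a, rfl⟩ := f.surjective a
    obtain ⟨b, rfl⟩ := f.surjective b
    have hab' : a < b := f.lt_iff_lt.1 hab
    obtain ⟨k, hk⟩ := h a b hab' (fun c hc hcc => by
      have hcI : c ∈ Set.Icc (0 : ℝ) 1 := ⟨a.2.1.trans hcc.1.le, hcc.2.le.trans b.2.2⟩
      refine hno _ (Finset.mem_image_of_mem _ hc) ?_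
      rw [Set.projIcc_of_mem zero_le_one hcI]
      exact ⟨f.lt_iff_lt.2 (show a < ⟨c, hcI⟩ from hcc.1),
        f.lt_iff_lt.2 (show (⟨c, hcI⟩ : unitInterval) < b from hcc.2)⟩)
    refine ⟨-k, fun y h1 h2 => ?_⟩
    obtain ⟨x, rfl⟩ := f.surjective y
    have e : ∀ z, f⁻¹ (f z) = z := fun z => f.symm_apply_apply z
    rw [e, e, hk x (f.le_iff_le.1 h1) (f.le_iff_le.1 h2), zpow_neg]
    field_simp
    ring

theorem IsDyadicPL.mul {f g : unitInterval ≃o unitInterval} (hf : IsDyadicPL f)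
    (hg : IsDyadicPL g) : IsDyadicPL (f * g) := by
  classical
  have key := hg.inv.isDyadic_apply
  obtain ⟨B, hB, h⟩ := hf
  obtain ⟨C, hC, h'⟩ := hg
  refine ⟨C ∪ B.image (fun c => (g⁻¹ (Set.projIcc 0 1 zero_le_one c) : ℝ)), ?_, ?_⟩
  · intro c hc
    rcases Finset.mem_union.1 hc with hc | hc
    · exact hC c hc
    obtain ⟨d, hd, rfl⟩ := Finset.mem_image.1 hc
    apply key
    rw [Set.coe_projIcc]
    rcases max_choice (0 : ℝ) (min 1 d) with h1 | h1 <;> rw [h1]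
    · exact ⟨0, 0, by simp⟩
    · rcases min_choice (1 : ℝ) d with h2 | h2 <;> rw [h2]
      · exact ⟨1, 0, by simp⟩
      · exact hB d hd
  · intro a b hab hno
    obtain ⟨k, hk⟩ := h' a b hab (fun c hc => hno c (Finset.mem_union_left _ hc))
    obtain ⟨l, hl⟩ := h (g a) (g b) (g.lt_iff_lt.2 hab) (fun c hc hcc => by
      have hcI : c ∈ Set.Icc (0 : ℝ) 1 := ⟨(g a).2.1.trans hcc.1.le, hcc.2.le.trans (g b).2.2⟩
      refine hno _ (Finset.mem_union_right _ (Finset.mem_image_of_mem _ hc)) ?_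
      rw [Set.projIcc_of_mem zero_le_one hcI]
      obtain ⟨d, hd⟩ := g.surjective ⟨c, hcI⟩
      have e : g⁻¹ (g d) = d := g.symm_apply_apply d
      rw [← hd, e]
      have hd' : ((g d : unitInterval) : ℝ) = c := by rw [hd]
      rw [← hd'] at hcc
      exact ⟨g.lt_iff_lt.1 (show g a < g d from hcc.1), g.lt_iff_lt.1 (show g d < g b from hcc.2)⟩)
    refine ⟨l + k, fun x h1 h2 => ?_⟩
    have e : ∀ z, (f * g) z = f (g z) := fun z => rfl
    rw [e, e, hl (g x) (g.monotone h1) (g.monotone h2), hk x h1 h2,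
      zpow_add₀ (two_ne_zero)]
    ring

/-- Thompson's group `F`: the group, under composition, of all orientation preserving piecewise
linear homeomorphisms of `[0,1]` with finitely many breakpoints, all of them dyadic rationals, and
with all slopes powers of two. -/
def F : Subgroup (unitInterval ≃o unitInterval) where
  carrier := {f | IsDyadicPL f}
  one_mem' := ⟨∅, by simp, fun a b _ _ => ⟨0, fun x _ _ => by
    have e : ∀ z, (1 : unitInterval ≃o unitInterval) z = z := fun z => rfl
    rw [e, e]; simp⟩⟩
  mul_mem' := IsDyadicPL.mul
  inv_mem' := IsDyadicPL.inv

/-! ### Tree pairs and the elements of `F` which they represent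

Finite rooted binary trees are terms of `BinaryTree Unit`: the empty tree `nil` (a single leaf, no
caret) or a root caret with a left and a right subtree. The number of carets is `numNodes`, the
number of leaves is `numLeaves`. Leaves are numbered from left to right, beginning with `0`.
A tree cuts `[0,1]` into dyadic intervals, one for each leaf, each caret halving an interval. -/

/-- The map `[0,1] → [0, numLeaves T]` which for every `i` maps the dyadic interval of the `i`-th
leaf of `T` affinely onto `[i, i+1]`. -/
noncomputable def leafCoord : BinaryTree Unit → ℝ → ℝ
  | .nil, x => x
  | .node _ l r, x =>
      if x ≤ 1 / 2 then leafCoord l (2 * x) else l.numLeaves + leafCoord r (2 * x - 1)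

/-- The map `[0, numLeaves T] → [0,1]` which for every `i` maps `[i, i+1]` affinely onto the dyadic
interval of the `i`-th leaf of `T`; it is inverse to `leafCoord T`. -/
noncomputable def leafPoint : BinaryTree Unit → ℝ → ℝ
  | .nil, y => y
  | .node _ l r, y =>
      if y ≤ l.numLeaves then leafPoint l y / 2 else (1 + leafPoint r (y - l.numLeaves)) / 2

theorem numLeaves_cast_node (l r : BinaryTree Unit) :
    (((BinaryTree.node () l r).numLeaves : ℕ) : ℝ) = (l.numLeaves : ℝ) + r.numLeaves := by
  simp [BinaryTree.numLeaves]

theorem leafCoord_mem (T : BinaryTree Unit) : ∀ x : ℝ, 0 ≤ x → x ≤ 1 →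
    0 ≤ leafCoord T x ∧ leafCoord T x ≤ T.numLeaves := by
  induction T with
  | nil => intro x h0 h1; simpa [leafCoord, BinaryTree.numLeaves] using ⟨h0, h1⟩
  | node u l r ihl ihr =>
    intro x h0 h1
    rw [numLeaves_cast_node]
    simp only [leafCoord]
    split_ifs with h
    · have := ihl (2 * x) (by linarith) (by linarith)
      have h2 : (0 : ℝ) ≤ r.numLeaves := Nat.cast_nonneg _
      constructor <;> linarith
    · have := ihr (2 * x - 1) (by linarith) (by linarith)
      have h2 : (0 : ℝ) ≤ l.numLeaves := Nat.cast_nonneg _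
      constructor <;> linarith

theorem leafPoint_mem (T : BinaryTree Unit) : ∀ y : ℝ, 0 ≤ y → y ≤ T.numLeaves →
    0 ≤ leafPoint T y ∧ leafPoint T y ≤ 1 := by
  induction T with
  | nil =>
    intro x h0 h1
    simp only [BinaryTree.numLeaves, Nat.cast_one] at h1
    exact ⟨h0, h1⟩
  | node u l r ihl ihr =>
    intro y h0 h1
    rw [numLeaves_cast_node] at h1
    simp only [leafPoint]
    split_ifs with h
    · have := ihl y h0 h
      constructor <;> linarith
    · have := ihr (y - l.numLeaves) (by linarith) (by linarith)
      constructor <;> linarith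

theorem leafPoint_zero (T : BinaryTree Unit) : leafPoint T 0 = 0 := by
  induction T with
  | nil => rfl
  | node u l r ihl ihr => simp [leafPoint, ihl]

theorem leafPoint_numLeaves (T : BinaryTree Unit) : leafPoint T T.numLeaves = 1 := by
  induction T with
  | nil => simp [leafPoint, BinaryTree.numLeaves]
  | node u l r ihl ihr =>
    have h : ¬ ((l.numLeaves : ℝ) + r.numLeaves ≤ l.numLeaves) := by
      have : (0 : ℝ) < r.numLeaves := by exact_mod_cast r.numLeaves_pos
      linarith
    rw [numLeaves_cast_node, leafPoint, if_neg h]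
    simp [ihr]

theorem leafPoint_strictMonoOn (T : BinaryTree Unit) : ∀ y z : ℝ, 0 ≤ y → y < z →
    z ≤ T.numLeaves → leafPoint T y < leafPoint T z := by
  induction T with
  | nil => intro y z _ h _; simpa [leafPoint] using h
  | node u l r ihl ihr =>
    intro y z h0 h h1
    rw [numLeaves_cast_node] at h1
    simp only [leafPoint]
    split_ifs with hy hz hz
    · have := ihl y z h0 h hz
      linarith
    · have h2 := (leafPoint_mem l y h0 hy).2
      have h3 := ihr 0 (z - l.numLeaves) le_rfl (by linarith) (by linarith)
      rw [leafPoint_zero] at h3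
      linarith
    · linarith
    · have := ihr (y - l.numLeaves) (z - l.numLeaves) (by linarith) (by linarith) (by linarith)
      linarith

theorem leafPoint_leafCoord (T : BinaryTree Unit) : ∀ x : ℝ, 0 ≤ x → x ≤ 1 →
    leafPoint T (leafCoord T x) = x := by
  induction T with
  | nil => intro x _ _; rfl
  | node u l r ihl ihr =>
    intro x h0 h1
    simp only [leafCoord]
    split_ifs with h
    · have h2 := leafCoord_mem l (2 * x) (by linarith) (by linarith)
      rw [leafPoint, if_pos h2.2, ihl _ (by linarith) (by linarith)]
      ring
    · have h2 := leafCoord_mem r (2 * x - 1) (by linarith) (by linarith)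
      have h3 := ihr (2 * x - 1) (by linarith) (by linarith)
      have h4 : 0 < leafCoord r (2 * x - 1) := by
        rcases eq_or_lt_of_le h2.1 with h5 | h5
        · rw [← h5, leafPoint_zero] at h3
          linarith
        · exact h5
      rw [leafPoint, if_neg (by linarith), add_sub_cancel_left, h3]
      ring

theorem leafCoord_leafPoint (T : BinaryTree Unit) (y : ℝ) (h0 : 0 ≤ y) (h1 : y ≤ T.numLeaves) :
    leafCoord T (leafPoint T y) = y := by
  have h2 := leafPoint_mem T y h0 h1
  have h3 := leafCoord_mem T _ h2.1 h2.2
  have h4 := leafPoint_leafCoord T _ h2.1 h2.2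
  rcases lt_trichotomy (leafCoord T (leafPoint T y)) y with h | h | h
  · have := leafPoint_strictMonoOn T _ _ h3.1 h h1
    linarith
  · exact h
  · have := leafPoint_strictMonoOn T _ _ h0 h h3.2
    linarith

theorem leafPoint_affine (T : BinaryTree Unit) : ∀ u v : ℝ, 0 ≤ u → u < v → v ≤ T.numLeaves →
    (∀ i : ℕ, ¬ (u < i ∧ (i : ℝ) < v)) →
    ∃ k : ℤ, ∀ y, u ≤ y → y ≤ v → leafPoint T y = leafPoint T u + (2 : ℝ) ^ k * (y - u) := by
  induction T with
  | nil => intro u v _ _ _ _; exact ⟨0, fun y _ _ => by simp [leafPoint]⟩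
  | node w l r ihl ihr =>
    intro u v h0 h h1 hno
    rw [numLeaves_cast_node] at h1
    by_cases hv : v ≤ l.numLeaves
    · obtain ⟨k, hk⟩ := ihl u v h0 h hv hno
      refine ⟨k - 1, fun y h2 h3 => ?_⟩
      rw [leafPoint, leafPoint, if_pos (h3.trans hv), if_pos (h.le.trans hv), hk y h2 h3,
        zpow_sub_one₀ two_ne_zero]
      ring
    · have hu : (l.numLeaves : ℝ) ≤ u := by
        by_contra hu
        exact hno l.numLeaves ⟨not_le.1 hu, not_le.1 hv⟩
      obtain ⟨k, hk⟩ := ihr (u - l.numLeaves) (v - l.numLeaves) (by linarith) (by linarith)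
        (by linarith) (fun i hi => hno (i + l.numLeaves) (by
          push_cast
          constructor <;> linarith [hi.1, hi.2]))
      have key : ∀ y, (l.numLeaves : ℝ) ≤ y →
          leafPoint (.node w l r) y = (1 + leafPoint r (y - l.numLeaves)) / 2 := by
        intro y hy
        rw [leafPoint]
        split_ifs with h2
        · have : y = l.numLeaves := le_antisymm h2 hy
          rw [this, leafPoint_numLeaves, sub_self, leafPoint_zero]
          norm_num
        · rfl
      refine ⟨k - 1, fun y h2 h3 => ?_⟩
      rw [key y (hu.trans h2), key u hu, hk (y - l.numLeaves) (by linarith) (by linarith),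
        zpow_sub_one₀ two_ne_zero]
      ring

theorem isDyadic_leafPoint (T : BinaryTree Unit) : ∀ i : ℤ, IsDyadic (leafPoint T i) := by
  have half : IsDyadic (1 / 2 : ℝ) := ⟨1, 1, by norm_num⟩
  induction T with
  | nil => intro i; exact isDyadic_int i
  | node u l r ihl ihr =>
    intro i
    simp only [leafPoint]
    split_ifs with h
    · rw [div_eq_mul_one_div]
      exact (ihl i).mul half
    · rw [div_eq_mul_one_div]
      have h1 := ihr (i - l.numLeaves)
      push_cast at h1
      have h2 := isDyadic_int 1
      push_cast at h2
      exact (h2.add h1).mul half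

/-- The piecewise linear homeomorphism of `[0,1]` of a pair `(S, T)` of trees with the same number
of leaves: for every `i` it maps the dyadic interval of the `i`-th leaf of `S` affinely onto that of
the `i`-th leaf of `T`. -/
noncomputable def treePairMap (S T : BinaryTree Unit) (h : S.numNodes = T.numNodes) :
    unitInterval ≃o unitInterval :=
  have hL : S.numLeaves = T.numLeaves := by
    rw [S.numLeaves_eq_numNodes_succ, T.numLeaves_eq_numNodes_succ, h]
  have mem : ∀ S T : BinaryTree Unit, S.numLeaves = T.numLeaves → ∀ x : unitInterval,
      leafPoint T (leafCoord S x) ∈ unitInterval := fun S T e x => by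
    have h1 := leafCoord_mem S x x.2.1 x.2.2
    exact leafPoint_mem T _ h1.1 (e ▸ h1.2)
  have inv : ∀ (S T : BinaryTree Unit), S.numLeaves = T.numLeaves → ∀ x : unitInterval,
      leafPoint S (leafCoord T (leafPoint T (leafCoord S x))) = x := fun S T e x => by
    have h1 := leafCoord_mem S x x.2.1 x.2.2
    rw [leafCoord_leafPoint T _ h1.1 (e ▸ h1.2), leafPoint_leafCoord S x x.2.1 x.2.2]
  have smono : StrictMono
      (fun x : unitInterval => (⟨leafPoint T (leafCoord S x), mem S T hL x⟩ : unitInterval)) := by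
    intro x y hxy
    have h1 := leafCoord_mem S x x.2.1 x.2.2
    have h2 := leafCoord_mem S y y.2.1 y.2.2
    refine leafPoint_strictMonoOn T _ _ h1.1 ?_ (hL ▸ h2.2)
    by_contra hle
    rcases eq_or_lt_of_le (not_lt.1 hle) with h3 | h3
    · have h4 := congrArg (leafPoint S) h3
      rw [leafPoint_leafCoord S x x.2.1 x.2.2, leafPoint_leafCoord S y y.2.1 y.2.2] at h4
      exact absurd hxy (by rw [Subtype.ext h4]; exact lt_irrefl _)
    · have h4 := leafPoint_strictMonoOn S _ _ h2.1 h3 h1.2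
      rw [leafPoint_leafCoord S x x.2.1 x.2.2, leafPoint_leafCoord S y y.2.1 y.2.2] at h4
      exact absurd hxy (not_lt.2 h4.le)
  { toFun := fun x => ⟨leafPoint T (leafCoord S x), mem S T hL x⟩
    invFun := fun x => ⟨leafPoint S (leafCoord T x), mem T S hL.symm x⟩
    left_inv := fun x => Subtype.ext (inv S T hL x)
    right_inv := fun x => Subtype.ext (inv T S hL.symm x)
    map_rel_iff' := smono.le_iff_le }

theorem treePairMap_apply (S T : BinaryTree Unit) (h : S.numNodes = T.numNodes)
    (x : unitInterval) : (treePairMap S T h x : ℝ) = leafPoint T (leafCoord S x) := rfl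

theorem treePairMap_mem (S T : BinaryTree Unit) (h : S.numNodes = T.numNodes) :
    treePairMap S T h ∈ F := by
  classical
  have hL : S.numLeaves = T.numLeaves := by
    rw [S.numLeaves_eq_numNodes_succ, T.numLeaves_eq_numNodes_succ, h]
  refine ⟨(Finset.range (S.numLeaves + 1)).image (fun i : ℕ => leafPoint S i), ?_, ?_⟩
  · intro c hc
    obtain ⟨i, -, rfl⟩ := Finset.mem_image.1 hc
    exact_mod_cast isDyadic_leafPoint S i
  · intro a b hab hno
    have ha := leafCoord_mem S a a.2.1 a.2.2
    have hb := leafCoord_mem S b b.2.1 b.2.2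
    have ea := leafPoint_leafCoord S a a.2.1 a.2.2
    have eb := leafPoint_leafCoord S b b.2.1 b.2.2
    have mono : ∀ x y : unitInterval, x ≤ y → leafCoord S x ≤ leafCoord S y := by
      intro x y hxy
      by_contra hlt
      have h1 := leafPoint_strictMonoOn S _ _ (leafCoord_mem S y y.2.1 y.2.2).1 (not_le.1 hlt)
        (leafCoord_mem S x x.2.1 x.2.2).2
      rw [leafPoint_leafCoord S x x.2.1 x.2.2, leafPoint_leafCoord S y y.2.1 y.2.2] at h1
      exact absurd hxy (not_le.2 h1)
    have hlt : leafCoord S a < leafCoord S b := by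
      refine lt_of_le_of_ne (mono a b hab.le) fun e => ?_
      have h1 := congrArg (leafPoint S) e
      rw [ea, eb] at h1
      rw [Subtype.ext h1] at hab
      exact lt_irrefl _ hab
    have hno' : ∀ i : ℕ, ¬ (leafCoord S a < i ∧ (i : ℝ) < leafCoord S b) := by
      rintro i ⟨h1, h2⟩
      have hi : (i : ℝ) ≤ S.numLeaves := h2.le.trans hb.2
      refine hno (leafPoint S i) (Finset.mem_image_of_mem _ (Finset.mem_range.2 ?_)) ⟨?_, ?_⟩
      · exact Nat.lt_succ_of_le (by exact_mod_cast hi)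
      · have := leafPoint_strictMonoOn S _ _ ha.1 h1 hi
        rwa [ea] at this
      · have := leafPoint_strictMonoOn S _ _ (Nat.cast_nonneg i) h2 hb.2
        rwa [eb] at this
    obtain ⟨k, hk⟩ := leafPoint_affine S _ _ ha.1 hlt hb.2 hno'
    obtain ⟨m, hm⟩ := leafPoint_affine T _ _ ha.1 hlt (hL ▸ hb.2) hno'
    refine ⟨m - k, fun x h1 h2 => ?_⟩
    have e1 := hk _ (mono _ _ h1) (mono _ _ h2)
    have e2 := hm _ (mono _ _ h1) (mono _ _ h2)
    rw [leafPoint_leafCoord S x x.2.1 x.2.2, ea] at e1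
    rw [treePairMap_apply, treePairMap_apply, e2, zpow_sub₀ two_ne_zero,
      show (x : ℝ) - a = (2 : ℝ) ^ k * (leafCoord S x - leafCoord S a) by linarith]
    field_simp

/-- `HasExposedCaret T i`: the leaves of `T` numbered `i` and `i + 1` are the two children of one
caret of `T`. -/
def HasExposedCaret : BinaryTree Unit → ℕ → Prop
  | .nil, _ => False
  | .node _ l r, i =>
      (l = .nil ∧ r = .nil ∧ i = 0) ∨ HasExposedCaret l i ∨
        ∃ j, i = l.numLeaves + j ∧ HasExposedCaret r j

/-- Nonempty reduced tree pairs. A pair of single carets counts as reduced (it represents the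
identity); a pair with at least two carets in each tree is reduced if there is no `i` such that the
leaves `i` and `i + 1` form a caret in both trees. -/
@[ext]
structure ReducedTreePair where
  source : BinaryTree Unit
  target : BinaryTree Unit
  numNodes_eq : source.numNodes = target.numNodes
  nonempty : 1 ≤ source.numNodes
  reduced : source.numNodes = 1 ∨ ∀ i, ¬ (HasExposedCaret source i ∧ HasExposedCaret target i)

/-- The size of a tree pair: the number of carets in either tree. -/
def ReducedTreePair.size (p : ReducedTreePair) : ℕ := p.source.numNodes

/-- The element of `F` represented by a reduced tree pair. -/
noncomputable def ReducedTreePair.toF (p : ReducedTreePair) : F :=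
  ⟨treePairMap p.source p.target p.numNodes_eq, treePairMap_mem _ _ _⟩

/-! ### Densities and the spectrum for the max stratification

Unordered `k`-tuples (with repetitions allowed) of reduced tree pairs are terms of
`Sym ReducedTreePair k`. -/

/-- The sphere of radius `n` of the max stratification: the unordered `k`-tuples in which the maximal
size of a component is `n`. -/
def maxSphere (k n : ℕ) : Set (Sym ReducedTreePair k) :=
  {t | (∀ p ∈ t, p.size ≤ n) ∧ ∃ p ∈ t, p.size = n}

theorem maxSphere_finite (k n : ℕ) : (maxSphere k n).Finite := by
  have h1 : {p : ReducedTreePair | p.size ≤ n}.Finite := by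
    have hT : {T : BinaryTree Unit | T.numNodes ≤ n}.Finite := by
      refine Set.Finite.subset ((Finset.range (n + 1)).biUnion
        BinaryTree.treesOfNumNodesEq).finite_toSet fun T hT => ?_
      simpa [BinaryTree.mem_treesOfNumNodesEq, Nat.lt_succ_iff] using hT
    refine Set.Finite.of_finite_image ((hT.prod hT).subset ?_)
      (f := fun p : ReducedTreePair => (p.source, p.target)) ?_
    · rintro _ ⟨p, hp, rfl⟩
      exact ⟨hp, show p.target.numNodes ≤ n from p.numNodes_eq ▸ hp⟩
    · intro p _ q _ hpq
      exact ReducedTreePair.ext (congrArg Prod.fst hpq) (congrArg Prod.snd hpq)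
  have : Finite {p : ReducedTreePair | p.size ≤ n} := h1
  have : Fintype {p : ReducedTreePair | p.size ≤ n} := Fintype.ofFinite _
  classical
  refine Set.Finite.subset (Set.finite_range
    (fun s : Sym {p : ReducedTreePair | p.size ≤ n} k => s.map Subtype.val)) ?_
  intro t ht
  refine ⟨t.attach.map (fun x => ⟨x.1, ht.1 x.1 x.2⟩), ?_⟩
  simp only [Sym.map_map]
  exact t.attach_map_coe

/-- The lower asymptotic density of a set `T` of unordered `k`-tuples for the max stratification,
`liminf |T ∩ Sph_k(n)| / |Sph_k(n)|` for `n → ∞`. -/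
noncomputable def maxLowerDensity (k : ℕ) (T : Set (Sym ReducedTreePair k)) : ℝ :=
  liminf (fun n : ℕ => ((T ∩ maxSphere k n).ncard : ℝ) / ((maxSphere k n).ncard : ℝ)) atTop

/-- The unordered `k`-tuples of reduced tree pairs generating a subgroup of `F` isomorphic
to `H`. -/
def generatingTuples (k : ℕ) (H : Type*) [Group H] : Set (Sym ReducedTreePair k) :=
  {t | Nonempty (Subgroup.closure {f : F | ∃ p ∈ t, p.toF = f} ≃* H)}

/-- (The isomorphism class of) the group `H` lies in the `k`-subgroup spectrum of `F` for the max
stratification: the set of `k`-tuples generating a copy of `H` has positive density. -/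
def InMaxSpec (k : ℕ) (H : Type*) [Group H] : Prop :=
  0 < maxLowerDensity k (generatingTuples k H)

/-! ### Wreath products -/

/-- The restricted wreath product `H ≀ ℤ`, as the subgroup of the unrestricted one of all elements
whose component in `∏_{ℤ} H` has finite support. -/
def restrictedWreath (H : Type*) [Group H] :
    Subgroup (RegularWreathProduct H (Multiplicative ℤ)) where
  carrier := {w | (Function.mulSupport w.left).Finite}
  one_mem' := by simp
  mul_mem' := by
    intro a b ha hb
    have h : (Function.mulSupport fun x => b.left (a.right⁻¹ * x)).Finite :=
      hb.preimage (mul_right_injective a.right⁻¹).injOn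
    exact (ha.union h).subset (Function.mulSupport_mul _ _)
  inv_mem' := by
    intro a ha
    have h : (Function.mulSupport fun x => a.left (a.right * x)).Finite :=
      ha.preimage (mul_right_injective a.right).injOn
    refine h.subset fun x hx => ?_
    simpa using hx

/-- The restricted wreath product `H ≀ ℤ`. -/
abbrev WreathZ (H : Type*) [Group H] : Type _ := restrictedWreath H

/-- Iterated restricted wreath products of `ℤ` with itself:
`iteratedWreathZ j = (⋯((ℤ ≀ ℤ) ≀ ℤ)⋯) ≀ ℤ` with `j + 1` factors `ℤ`. -/
def iteratedWreathZ : ℕ → GrpCat.{0}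
  | 0 => GrpCat.of (Multiplicative ℤ)
  | j + 1 => GrpCat.of (WreathZ (iteratedWreathZ j))

end ThompsonSpectrum

namespace ThompsonSpectrum

/-! ### Counting reduced pairs: a recurrence -/

/-! Write `r n` for the number of reduced pairs of size `n`. Everything rests on two growth facts,
valid for large `n`: `r (n + 1) ≤ C * r n` and `∑ m ≤ n, r m ≤ C * r n`
(`exists_numReduced_bounds`). They show that the sphere of radius `n` has order of magnitude `(r n)
^ k`, and that shifting `n` by a constant changes this by a bounded factor only. Hence a group lies
in the `k`-spectrum as soon as some injection sends `c * (r n) ^ k` objects to generating tuples in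
the sphere of radius `n + d`, with `d` fixed (`inMaxSpec_of_le_ncard`), and membership in turn
yields that many tuples (`InMaxSpec.le_ncard`).

Growth. Scanning the positions of common exposed carets from left to right gives a recurrence for
pairs reduced up to position `i`, starting from squares of Catalan numbers. These squares are the
moments of a measure `ν` on `[0,16]`, so the recurrence becomes `r n = ∫ redPoly n dν` for `n ≥ 2`.
On `[0,4]` the polynomials are at most `5 ^ n` in absolute value; on `[4,16]` consecutive ones have
ratio between 2 and 16; on `[8,16]`, which has positive mass, they are at least `6 ^ n`. The part
over `[4,16]` dominates and grows regularly.

Groups. Each construction transforms a given tuple by a fixed injective operation and adds entries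
containing an arbitrary reduced pair `p` of size `n`; every free `p` contributes one factor `r n`.

For `H × ℤ`, the tuple is squeezed into `[0,1/2]` and `p` into `[1/2,1]`; a nontrivial homeomorphism
preserving order has infinite order. For `H ≀ ℤ`, the tuple is squeezed into `[1/4,1/2]` and the new
entry maps `1/4` to `1/2`, with `p` grafted at its last leaf: the translates of `[1/4,1/2)` are
disjoint, so the copies of `H` commute and the new entry shifts them (`Displaced.nonempty_equiv`).

For `F` and any `k ≥ 2`, the two standard generators act on `[0,1/2]`, and arbitrary elements `a`,
`b` are attached to them in disjoint parts of `[1/2,1]`. The exponents of `a` and `b` in a product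
are determined by the slopes at the two ends of its action on `[0,1/2]`, so restriction to `[0,1/2]`
loses nothing and the group is still `F`. The remaining entries act on `[0,1/2]` by elements that
are trivial near both ends, and change nothing. Placing such a pair of generators next to a given
tuple yields `H × F`, and induction gives the powers of `F`. -/

theorem hasExposedCaret_lt {T : BinaryTree Unit} : ∀ {i : ℕ}, HasExposedCaret T i →
    i + 1 < T.numLeaves := by
  induction T with
  | nil => intro i h; exact h.elim
  | node u l r ihl ihr =>
    rintro i (⟨rfl, rfl, rfl⟩ | h | ⟨j, rfl, h⟩)
    · simp
    · have := ihl h; simp only [BinaryTree.numLeaves]; omega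
    · have := ihr h; simp only [BinaryTree.numLeaves]; omega

/-- Leaf `i + 1` cannot be both a right and a left child. A common caret at `i` therefore rules out
one at `i - 1`, which is the source of the index `i - 1` in the recurrence below. -/
theorem not_hasExposedCaret_succ {T : BinaryTree Unit} : ∀ {i : ℕ}, HasExposedCaret T i →
    ¬ HasExposedCaret T (i + 1) := by
  induction T with
  | nil => intro i h; exact h.elim
  | node u l r ihl ihr =>
    intro i h h'
    have hlt := hasExposedCaret_lt h'
    simp only [BinaryTree.numLeaves] at hlt
    rcases h with ⟨rfl, rfl, rfl⟩ | h | ⟨j, rfl, h⟩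
    · simp at hlt
    · have hi := hasExposedCaret_lt h
      rcases h' with ⟨rfl, rfl, h0⟩ | h' | ⟨j, hj, h'⟩
      · omega
      · exact ihl h h'
      · omega
    · rcases h' with ⟨rfl, rfl, h0⟩ | h' | ⟨j', hj, h'⟩
      · omega
      · have := hasExposedCaret_lt h'; omega
      · obtain rfl : j' = j + 1 := by omega
        exact ihr h h'

/-- The tree obtained from a tree by replacing the `i`-th leaf by a caret. -/
def expandLeaf : BinaryTree Unit → ℕ → BinaryTree Unit
  | .nil, _ => .node () .nil .nil
  | .node _ l r, i =>
      if i < l.numLeaves then .node () (expandLeaf l i) r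
      else .node () l (expandLeaf r (i - l.numLeaves))

theorem numNodes_expandLeaf (T : BinaryTree Unit) : ∀ i,
    (expandLeaf T i).numNodes = T.numNodes + 1 := by
  induction T with
  | nil => intro i; rfl
  | node u l r ihl ihr =>
    intro i
    simp only [expandLeaf]
    split_ifs
    · simp [ihl]; omega
    · simp [ihr]; omega

theorem numLeaves_expandLeaf (T : BinaryTree Unit) (i : ℕ) :
    (expandLeaf T i).numLeaves = T.numLeaves + 1 := by
  rw [BinaryTree.numLeaves_eq_numNodes_succ, BinaryTree.numLeaves_eq_numNodes_succ,
    numNodes_expandLeaf]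

theorem expandLeaf_ne_nil (T : BinaryTree Unit) (i : ℕ) : expandLeaf T i ≠ .nil := fun h => by
  have := numNodes_expandLeaf T i
  rw [h] at this
  simp at this

theorem hasExposedCaret_expandLeaf (T : BinaryTree Unit) : ∀ i, i < T.numLeaves →
    HasExposedCaret (expandLeaf T i) i := by
  induction T with
  | nil => intro i h; simp at h; exact Or.inl ⟨rfl, rfl, h⟩
  | node u l r ihl ihr =>
    intro i h
    simp only [BinaryTree.numLeaves] at h
    simp only [expandLeaf]
    split_ifs with h'
    · exact Or.inr (Or.inl (ihl i h'))
    · exact Or.inr (Or.inr ⟨i - l.numLeaves, by omega, ihr _ (by omega)⟩)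

theorem expandLeaf_injective (T : BinaryTree Unit) : ∀ (T' : BinaryTree Unit) (i : ℕ),
    i < T.numLeaves → expandLeaf T i = expandLeaf T' i → T = T' := by
  induction T with
  | nil =>
    intro T' i _ h
    cases T' with
    | nil => rfl
    | node u l r =>
      have h1 := numNodes_expandLeaf .nil i
      rw [h, numNodes_expandLeaf] at h1
      simp at h1
  | node u l r ihl ihr =>
    intro T' i hi h
    cases T' with
    | nil =>
      have h1 := numNodes_expandLeaf .nil i
      rw [← h, numNodes_expandLeaf] at h1
      simp at h1
    | node u' l' r' =>
      simp only [BinaryTree.numLeaves] at hi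
      simp only [expandLeaf] at h
      split_ifs at h with h1 h2 h2
      · injection h with _ h3 h4
        rw [ihl _ _ h1 h3, h4]
      · injection h with _ h3 h4
        rw [← h3, numLeaves_expandLeaf] at h2
        omega
      · injection h with _ h3 h4
        rw [h3, numLeaves_expandLeaf] at h1
        omega
      · injection h with _ h3 h4
        rw [← h3] at h4
        rw [ihr _ _ (by omega) h4, h3]

theorem exists_expandLeaf_eq (T : BinaryTree Unit) : ∀ i, HasExposedCaret T i →
    ∃ T', i < T'.numLeaves ∧ expandLeaf T' i = T := by
  induction T with
  | nil => intro i h; exact h.elim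
  | node u l r ihl ihr =>
    rintro i (⟨rfl, rfl, rfl⟩ | h | ⟨j, rfl, h⟩)
    · exact ⟨.nil, by simp, rfl⟩
    · obtain ⟨T', h1, rfl⟩ := ihl i h
      exact ⟨.node () T' r, by simp only [BinaryTree.numLeaves]; omega,
        by simp [expandLeaf, h1]⟩
    · obtain ⟨T', h1, rfl⟩ := ihr j h
      exact ⟨.node () l T', by simp only [BinaryTree.numLeaves]; omega,
        by simp [expandLeaf]⟩

/-- Both leaves `j` and `j + 1` lie strictly to the left of the expanded leaf, so neither their
numbers nor their parents change. -/
theorem hasExposedCaret_expandLeaf_iff (T : BinaryTree Unit) : ∀ i j, j + 1 < i →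
    i < T.numLeaves → (HasExposedCaret (expandLeaf T i) j ↔ HasExposedCaret T j) := by
  induction T with
  | nil => intro i j h1 h2; simp at h2; omega
  | node u l r ihl ihr =>
    intro i j hj hi
    simp only [BinaryTree.numLeaves] at hi
    simp only [expandLeaf]
    split_ifs with h
    · simp only [HasExposedCaret, ihl i j hj h, expandLeaf_ne_nil, numLeaves_expandLeaf]
      have h1 : ∀ k, ¬ (j = l.numLeaves + 1 + k ∧ HasExposedCaret r k) := by rintro k ⟨h1, -⟩; omega
      have h2 : ∀ k, ¬ (j = l.numLeaves + k ∧ HasExposedCaret r k) := by rintro k ⟨h1, -⟩; omega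
      have h3 : ¬ (l = .nil ∧ r = .nil ∧ j = 0) := by rintro ⟨rfl, -, -⟩; simp at h; omega
      simp [h1, h2, h3]
    · simp only [HasExposedCaret, expandLeaf_ne_nil]
      have h3 : ¬ (l = .nil ∧ r = .nil ∧ j = 0) := by
        rintro ⟨rfl, rfl, -⟩; simp at hi; omega
      simp only [false_and, and_false, false_or, h3]
      refine or_congr Iff.rfl (exists_congr fun k => and_congr_right fun hk => ?_)
      exact ihr _ _ (by omega) (by omega)

/-- The pairs of trees with `n` carets without common exposed caret at a position below `i`. -/
def pairsReducedBelow (n i : ℕ) : Set (BinaryTree Unit × BinaryTree Unit) :=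
  {q | q.1.numNodes = n ∧ q.2.numNodes = n ∧
    ∀ j < i, ¬ (HasExposedCaret q.1 j ∧ HasExposedCaret q.2 j)}

theorem pairsReducedBelow_zero (n : ℕ) : pairsReducedBelow n 0 =
    ((BinaryTree.treesOfNumNodesEq n ×ˢ BinaryTree.treesOfNumNodesEq n :
      Finset (BinaryTree Unit × BinaryTree Unit)) : Set _) := by
  ext q
  simp [pairsReducedBelow]

theorem pairsReducedBelow_finite (n i : ℕ) : (pairsReducedBelow n i).Finite := by
  refine Set.Finite.subset (t := pairsReducedBelow n i) (s := pairsReducedBelow n 0) ?_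
    (fun q hq => ⟨hq.1, hq.2.1, by simp⟩)
  rw [pairsReducedBelow_zero]
  exact Finset.finite_toSet _

theorem ncard_pairsReducedBelow_zero (n : ℕ) :
    (pairsReducedBelow n 0).ncard = catalan n ^ 2 := by
  rw [pairsReducedBelow_zero, Set.ncard_coe_finset, Finset.card_product,
    BinaryTree.treesOfNumNodesEq_card_eq_catalan, sq]

/-- Among pairs without common caret below `i`, those with a common caret at `i` arise by expanding
leaf `i` in both trees of a unique smaller pair. That pair may have a common caret at `i - 1`, since
the expansion destroys it; only positions below `i - 1` are constrained. For `i = 0` truncated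
subtraction gives the right value: no constraint. -/
theorem ncard_pairsReducedBelow_add (n i : ℕ) (hi : i ≤ n) :
    (pairsReducedBelow (n + 1) (i + 1)).ncard + (pairsReducedBelow n (i - 1)).ncard =
      (pairsReducedBelow (n + 1) i).ncard := by
  have hinj : Set.InjOn (fun q : BinaryTree Unit × BinaryTree Unit =>
      (expandLeaf q.1 i, expandLeaf q.2 i)) (pairsReducedBelow n (i - 1)) := by
    rintro ⟨S, T⟩ h ⟨S', T'⟩ h' he
    have hS : S.numLeaves = n + 1 := by rw [BinaryTree.numLeaves_eq_numNodes_succ, h.1]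
    have hT : T.numLeaves = n + 1 := by rw [BinaryTree.numLeaves_eq_numNodes_succ, h.2.1]
    rw [Prod.mk.injEq] at he
    rw [expandLeaf_injective S S' i (by omega) he.1, expandLeaf_injective T T' i (by omega) he.2]
  rw [← hinj.ncard_image, ← Set.ncard_union_eq ?_ (pairsReducedBelow_finite _ _)
    ((pairsReducedBelow_finite _ _).image _)]
  · congr 1
    ext ⟨S, T⟩
    constructor
    · rintro (h | ⟨⟨S', T'⟩, h, he⟩)
      · exact ⟨h.1, h.2.1, fun j hj => h.2.2 j (by omega)⟩
      · rw [Prod.mk.injEq] at he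
        obtain ⟨rfl, rfl⟩ := he
        have hS : S'.numLeaves = n + 1 := by rw [BinaryTree.numLeaves_eq_numNodes_succ, h.1]
        have hT : T'.numLeaves = n + 1 := by rw [BinaryTree.numLeaves_eq_numNodes_succ, h.2.1]
        refine ⟨by rw [numNodes_expandLeaf, h.1], by rw [numNodes_expandLeaf, h.2.1], ?_⟩
        rintro j hj ⟨h1, h2⟩
        rcases Nat.lt_or_ge (j + 1) i with h3 | h3
        · exact h.2.2 j (by omega) ⟨(hasExposedCaret_expandLeaf_iff S' _ _ h3 (by omega)).1 h1,
            (hasExposedCaret_expandLeaf_iff T' _ _ h3 (by omega)).1 h2⟩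
        · obtain rfl : i = j + 1 := by omega
          exact not_hasExposedCaret_succ h1 (hasExposedCaret_expandLeaf S' _ (by omega))
    · intro h
      by_cases hc : HasExposedCaret S i ∧ HasExposedCaret T i
      · right
        obtain ⟨S', hS, rfl⟩ := exists_expandLeaf_eq S i hc.1
        obtain ⟨T', hT, rfl⟩ := exists_expandLeaf_eq T i hc.2
        refine ⟨(S', T'), ⟨?_, ?_, ?_⟩, rfl⟩
        · have := h.1; rw [numNodes_expandLeaf] at this; simpa using this
        · have := h.2.1; rw [numNodes_expandLeaf] at this; simpa using this
        · rintro j hj ⟨h1, h2⟩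
          exact h.2.2 j (by omega) ⟨(hasExposedCaret_expandLeaf_iff _ _ _ (by omega) hS).2 h1,
            (hasExposedCaret_expandLeaf_iff _ _ _ (by omega) hT).2 h2⟩
      · refine Or.inl ⟨h.1, h.2.1, fun j hj => ?_⟩
        rcases Nat.lt_or_ge j i with h3 | h3
        · exact h.2.2 j h3
        · obtain rfl : j = i := by omega
          exact hc
  · rw [Set.disjoint_left]
    rintro _ h ⟨⟨S', T'⟩, h', rfl⟩
    have hS : S'.numLeaves = n + 1 := by rw [BinaryTree.numLeaves_eq_numNodes_succ, h'.1]
    have hT : T'.numLeaves = n + 1 := by rw [BinaryTree.numLeaves_eq_numNodes_succ, h'.2.1]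
    exact h.2.2 i (by omega) ⟨hasExposedCaret_expandLeaf S' _ (by omega),
      hasExposedCaret_expandLeaf T' _ (by omega)⟩

/-- The number of reduced tree pairs of size `n`. -/
noncomputable def numReduced (n : ℕ) : ℕ := {p : ReducedTreePair | p.size = n}.ncard

/-- A tree with `n` carets has `n + 1` leaves, so exposed carets occur only at positions below `n`.
The bound `2 ≤ n` excludes the pair of single carets, which is reduced by convention only. -/
theorem numReduced_eq (n : ℕ) (hn : 2 ≤ n) : numReduced n = (pairsReducedBelow n n).ncard := by
  have hinj : Function.Injective (fun p : ReducedTreePair => (p.source, p.target)) := by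
    intro p q h
    rw [Prod.mk.injEq] at h
    exact ReducedTreePair.ext h.1 h.2
  rw [numReduced, ← Set.ncard_image_of_injective _ hinj]
  congr 1
  ext ⟨S, T⟩
  constructor
  · rintro ⟨p, hp, he⟩
    rw [Prod.mk.injEq] at he
    obtain ⟨rfl, rfl⟩ := he
    have hp' : p.source.numNodes = n := hp
    refine ⟨hp', p.numNodes_eq ▸ hp', fun j _ => ?_⟩
    rcases p.reduced with h | h
    · omega
    · exact h j
  · rintro ⟨h1, h2, h3⟩
    simp only at h1 h2 h3
    refine ⟨⟨S, T, h1.trans h2.symm, by omega, Or.inr fun i hi => ?_⟩, h1, rfl⟩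
    have := hasExposedCaret_lt hi.1
    rw [BinaryTree.numLeaves_eq_numNodes_succ, h1] at this
    exact h3 i (by omega) hi


/-! ### Squares of Catalan numbers as moments -/

-- The measure is the law of `4 sin² θ` under the density `(2/π) cos² θ` on `(0, π]`; its moments
-- reduce to Wallis integrals.
open MeasureTheory in
theorem exists_measure_catalan : ∃ μ : Measure ℝ, IsFiniteMeasure μ ∧
    (∀ᵐ x ∂μ, x ∈ Set.Icc (0 : ℝ) 4) ∧ ∀ n : ℕ, ∫ x, x ^ n ∂μ = catalan n := by
  have hpi := Real.pi_pos
  set w : ℝ → NNReal := fun θ => (2 / Real.pi * Real.cos θ ^ 2).toNNReal with hw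
  have hwm : Measurable w := by fun_prop
  have hfm : Measurable fun θ : ℝ => 4 * Real.sin θ ^ 2 := by fun_prop
  set μ₀ := (volume.restrict (Set.Ioc 0 Real.pi)).withDensity fun θ => (w θ : ENNReal) with hμ₀
  have hfin : IsFiniteMeasure μ₀ := by
    refine isFiniteMeasure_withDensity ?_
    refine ((setLIntegral_mono (g := fun _ => ENNReal.ofReal (2 / Real.pi)) measurable_const
      fun θ _ => ?_).trans_lt ?_).ne
    · rw [hw, ← ENNReal.ofReal]
      refine ENNReal.ofReal_le_ofReal (mul_le_of_le_one_right (by positivity) ?_)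
      exact Real.cos_sq_le_one θ
    · rw [setLIntegral_const]
      exact ENNReal.mul_lt_top ENNReal.ofReal_lt_top (by simp)
  refine ⟨μ₀.map fun θ => 4 * Real.sin θ ^ 2, inferInstance, ?_, fun n => ?_⟩
  · refine (ae_map_iff hfm.aemeasurable (p := fun x => x ∈ Set.Icc (0 : ℝ) 4)
      measurableSet_Icc).2 ?_
    refine ae_of_all _ fun θ => ⟨by positivity, ?_⟩
    have := Real.sin_sq_le_one θ
    linarith
  · rw [integral_map hfm.aemeasurable (by fun_prop), hμ₀,
      integral_withDensity_eq_integral_smul hwm,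
      ← intervalIntegral.integral_of_le hpi.le]
    have h1 : ∀ θ : ℝ, w θ • (4 * Real.sin θ ^ 2) ^ n =
        2 / Real.pi * 4 ^ n * (Real.sin θ ^ (2 * n) - Real.sin θ ^ (2 * n + 2)) := by
      intro θ
      rw [NNReal.smul_def, smul_eq_mul, hw, Real.coe_toNNReal _ (by positivity), Real.cos_sq',
        mul_pow, ← pow_mul, pow_add]
      ring
    simp_rw [h1]
    rw [intervalIntegral.integral_const_mul, intervalIntegral.integral_sub
      (by apply Continuous.intervalIntegrable; fun_prop)
      (by apply Continuous.intervalIntegrable; fun_prop), integral_sin_pow]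
    -- Wallis' formula for even powers, by induction through the recurrence of the central binomial
    -- coefficients.
    have h2 : ∀ n : ℕ, ∫ x in (0 : ℝ)..Real.pi, Real.sin x ^ (2 * n) =
        Real.pi * n.centralBinom / 4 ^ n := by
      intro n
      induction n with
      | zero => simp
      | succ n ih =>
        rw [mul_add, mul_one, integral_sin_pow, ih]
        have := n.succ_mul_centralBinom_succ
        have h3 : ((n : ℝ) + 1) * (n + 1).centralBinom = 2 * (2 * n + 1) * n.centralBinom := by
          exact_mod_cast this
        simp only [Real.sin_zero, Real.sin_pi, Nat.cast_mul, Nat.cast_ofNat]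
        have h4 : ((n + 1).centralBinom : ℝ) = 2 * (2 * n + 1) * n.centralBinom / (n + 1) := by
          rw [← h3]; field_simp
        rw [h4]
        field_simp
        simp
        ring
    rw [h2]
    have h5 : ((n : ℝ) + 1) * catalan n = n.centralBinom := by
      exact_mod_cast succ_mul_catalan_eq_centralBinom n
    rw [← h5]
    simp only [Real.sin_zero, Real.sin_pi, Nat.cast_mul, Nat.cast_ofNat]
    field_simp
    simp
    ring

-- Multiplying two independent variables squares the moments.
open MeasureTheory in
theorem exists_measure_catalan_sq : ∃ ν : Measure ℝ, IsFiniteMeasure ν ∧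
    (∀ᵐ x ∂ν, x ∈ Set.Icc (0 : ℝ) 16) ∧ ∀ n : ℕ, ∫ x, x ^ n ∂ν = (catalan n : ℝ) ^ 2 := by
  obtain ⟨μ, hμ, h1, h2⟩ := exists_measure_catalan
  have hm : Measurable fun q : ℝ × ℝ => q.1 * q.2 := by fun_prop
  refine ⟨(μ.prod μ).map fun q => q.1 * q.2, inferInstance, ?_, fun n => ?_⟩
  · refine (ae_map_iff hm.aemeasurable (p := fun x => x ∈ Set.Icc (0 : ℝ) 16)
      measurableSet_Icc).2 ?_
    have h3 := Measure.quasiMeasurePreserving_fst.ae (μa := μ.prod μ) h1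
    have h4 := Measure.quasiMeasurePreserving_snd.ae (μa := μ.prod μ) h1
    filter_upwards [h3, h4] with q h5 h6
    exact ⟨mul_nonneg h5.1 h6.1, by nlinarith [h5.1, h5.2, h6.1, h6.2]⟩
  · rw [integral_map hm.aemeasurable (by fun_prop)]
    simp_rw [mul_pow]
    rw [integral_prod_mul (fun x : ℝ => x ^ n) (fun x : ℝ => x ^ n), h2, sq]

/-! ### The number of reduced pairs as an integral -/

/-- The polynomials whose moments count reduced tree pairs. -/
def redPoly : ℕ → ℝ → ℝ
  | 0, _ => 1
  | 1, x => x - 1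
  | n + 2, x => x * redPoly (n + 1) x - x * redPoly n x

theorem continuous_redPoly : ∀ n, Continuous (redPoly n)
  | 0 => continuous_const
  | 1 => by change Continuous fun x : ℝ => x - 1; fun_prop
  | n + 2 => by
    have h1 := continuous_redPoly n
    have h2 := continuous_redPoly (n + 1)
    simp only [redPoly]
    fun_prop

theorem abs_redPoly_le (x : ℝ) (h0 : 0 ≤ x) (h1 : x ≤ 4) : ∀ n, |redPoly n x| ≤ 5 ^ n
  | 0 => by simp [redPoly]
  | 1 => by simp only [redPoly, pow_one]; rw [abs_le]; constructor <;> linarith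
  | n + 2 => by
    have h2 := abs_redPoly_le x h0 h1 n
    have h3 := abs_redPoly_le x h0 h1 (n + 1)
    have h4 : (0 : ℝ) < 5 ^ n := by positivity
    simp only [redPoly]
    calc |x * redPoly (n + 1) x - x * redPoly n x|
        ≤ |x * redPoly (n + 1) x| + |x * redPoly n x| := abs_sub _ _
      _ = x * (|redPoly (n + 1) x| + |redPoly n x|) := by
          rw [abs_mul, abs_mul, abs_of_nonneg h0]; ring
      _ ≤ 4 * (5 ^ (n + 1) + 5 ^ n) := by gcongr
      _ ≤ 5 ^ (n + 2) := by rw [pow_succ _ (n + 1), pow_succ _ n]; linarith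

/-- The characteristic equation `λ² - xλ + x = 0` of the recursion has real roots for `x ≥ 4`,
whence the threshold. In the induction, `x * redPoly n x ≤ 2 * redPoly (n + 1) x` makes the next
ratio at least `x - 2`, which is at least `x / 2` because `x ≥ 4`. -/
theorem redPoly_succ_ge_half (x : ℝ) (hx : 4 ≤ x) :
    ∀ n, 0 < redPoly n x ∧ x / 2 * redPoly n x ≤ redPoly (n + 1) x
  | 0 => by simp only [redPoly]; constructor <;> linarith
  | n + 1 => by
    obtain ⟨h1, h2⟩ := redPoly_succ_ge_half x hx n
    have h3 : 0 < redPoly (n + 1) x := lt_of_lt_of_le (by positivity) h2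
    refine ⟨h3, ?_⟩
    simp only [redPoly]
    nlinarith

theorem redPoly_pos {x : ℝ} (hx : 4 ≤ x) (n : ℕ) : 0 < redPoly n x :=
  (redPoly_succ_ge_half x hx n).1

theorem two_mul_redPoly_le {x : ℝ} (hx : 4 ≤ x) (n : ℕ) : 2 * redPoly n x ≤ redPoly (n + 1) x := by
  have := redPoly_succ_ge_half x hx n
  nlinarith

theorem redPoly_succ_le {x : ℝ} (hx : 4 ≤ x) (n : ℕ) : redPoly (n + 1) x ≤ x * redPoly n x := by
  cases n with
  | zero => simp only [redPoly]; linarith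
  | succ n =>
    have := redPoly_pos hx n
    simp only [redPoly]
    nlinarith

/-- The ratio of consecutive values is at least `x - 2 ≥ 6`. This beats the bound `5 ^ n` on
`[0,4]`. -/
theorem six_pow_le_redPoly {x : ℝ} (hx : 8 ≤ x) (n : ℕ) : 6 ^ n ≤ redPoly n x := by
  induction n with
  | zero => simp [redPoly]
  | succ n ih =>
    have h : (x - 2) * redPoly n x ≤ redPoly (n + 1) x := by
      cases n with
      | zero => simp only [redPoly]; linarith
      | succ n =>
        have := redPoly_succ_ge_half x (by linarith) n
        simp only [redPoly] at *
        nlinarith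
    have := redPoly_pos (x := x) (by linarith) n
    rw [pow_succ]
    nlinarith


open MeasureTheory in
theorem integrable_of_continuous {ν : Measure ℝ} [IsFiniteMeasure ν]
    (h : ∀ᵐ x ∂ν, x ∈ Set.Icc (0 : ℝ) 16) {f : ℝ → ℝ} (hf : Continuous f) : Integrable f ν := by
  obtain ⟨C, hC⟩ := isCompact_Icc.exists_bound_of_continuousOn (s := Set.Icc (0 : ℝ) 16)
    hf.continuousOn
  exact Integrable.of_bound hf.aestronglyMeasurable C (h.mono fun x hx => hC x hx)

-- Under the integral, the counting recurrence turns into the recursion of `redPoly` multiplied by a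
-- power of `x`. For `i = n` that power disappears.
open MeasureTheory in
theorem ncard_pairsReducedBelow_eq_integral {ν : Measure ℝ} [IsFiniteMeasure ν]
    (h : ∀ᵐ x ∂ν, x ∈ Set.Icc (0 : ℝ) 16)
    (hν : ∀ n : ℕ, ∫ x, x ^ n ∂ν = (catalan n : ℝ) ^ 2) :
    ∀ i n : ℕ, i ≤ n → ((pairsReducedBelow n i).ncard : ℝ) = ∫ x, x ^ (n - i) * redPoly i x ∂ν
  | 0, n, _ => by
    simp only [redPoly, mul_one, Nat.sub_zero, hν, ncard_pairsReducedBelow_zero]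
    push_cast
    rfl
  | 1, n, hn => by
    obtain ⟨n, rfl⟩ := Nat.exists_eq_add_of_le' hn
    have h1 := ncard_pairsReducedBelow_add n 0 (Nat.zero_le _)
    rw [Nat.zero_sub, ncard_pairsReducedBelow_zero, ncard_pairsReducedBelow_zero] at h1
    have h2 : ((pairsReducedBelow (n + 1) 1).ncard : ℝ) + (catalan n : ℝ) ^ 2 =
      (catalan (n + 1) : ℝ) ^ 2 := by exact_mod_cast h1
    rw [← hν, ← hν] at h2
    rw [eq_sub_of_add_eq h2, ← integral_sub (integrable_of_continuous h (by fun_prop))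
      (integrable_of_continuous h (by fun_prop))]
    refine integral_congr_ae (ae_of_all _ fun x => ?_)
    simp only [redPoly, Nat.add_sub_cancel]
    ring
  | i + 2, n, hn => by
    obtain ⟨n, rfl⟩ := Nat.exists_eq_add_of_le' (show 1 ≤ n by omega)
    have h1 := ncard_pairsReducedBelow_add n (i + 1) (by omega)
    rw [Nat.add_sub_cancel] at h1
    have h2 : ((pairsReducedBelow (n + 1) (i + 2)).ncard : ℝ) + (pairsReducedBelow n i).ncard =
      (pairsReducedBelow (n + 1) (i + 1)).ncard := by exact_mod_cast h1
    rw [ncard_pairsReducedBelow_eq_integral h hν i n (by omega),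
      ncard_pairsReducedBelow_eq_integral h hν (i + 1) (n + 1) (by omega)] at h2
    have c1 := continuous_redPoly i
    have c2 := continuous_redPoly (i + 1)
    rw [eq_sub_of_add_eq h2, ← integral_sub (integrable_of_continuous h (by fun_prop))
      (integrable_of_continuous h (by fun_prop))]
    refine integral_congr_ae (ae_of_all _ fun x => ?_)
    obtain ⟨m, hm⟩ := Nat.exists_eq_add_of_le (show i + 1 ≤ n by omega)
    simp only [redPoly, show n + 1 - (i + 1) = m + 1 by omega, show n - i = m + 1 by omega,
      show n + 1 - (i + 2) = m by omega]
    ring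

open MeasureTheory in
/-- Up to an error of order `5 ^ n`, the number of reduced pairs grows at a rate between two and
sixteen in each step. -/
theorem exists_numReduced_approx : ∃ (I : ℕ → ℝ) (M c : ℝ), 0 < c ∧
    (∀ n, 2 ≤ n → |(numReduced n : ℝ) - I n| ≤ M * 5 ^ n) ∧
    (∀ n, 2 * I n ≤ I (n + 1)) ∧ (∀ n, I (n + 1) ≤ 16 * I n) ∧ ∀ n, c * 6 ^ n ≤ I n := by
  obtain ⟨ν, hfin, h, hν⟩ := exists_measure_catalan_sq
  have hint : ∀ n, Integrable (redPoly n) ν := fun n =>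
    integrable_of_continuous h (continuous_redPoly n)
  -- Otherwise `ν`, whose total mass is `catalan 0 ^ 2 = 1`, would live on `[0,8]` and its 14th
  -- moment would be at most `8 ^ 14`. But `catalan 14 = 2674440`, whose square exceeds `8 ^ 14`.
  have hpos : 0 < ν.real (Set.Ici 8) := by
    by_contra h0
    have h0 : ν.real (Set.Ici 8) = 0 := le_antisymm (not_lt.1 h0) measureReal_nonneg
    rw [measureReal_eq_zero_iff] at h0
    have h1 : ∀ᵐ x ∂ν, x ^ 14 ≤ (8 : ℝ) ^ 14 := by
      have h2 : ∀ᵐ x ∂ν, x ∉ Set.Ici (8 : ℝ) := measure_eq_zero_iff_ae_notMem.1 h0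
      filter_upwards [h, h2] with x hx hx'
      exact pow_le_pow_left₀ hx.1 (not_le.1 hx').le 14
    have h3 := integral_mono_ae (integrable_of_continuous h (continuous_pow 14))
      (integrable_const _) h1
    have h4 := hν 0
    simp only [pow_zero, integral_const, smul_eq_mul, mul_one, catalan_zero, Nat.cast_one,
      one_pow] at h4
    rw [hν, integral_const, h4, catalan_eq_centralBinom_div] at h3
    have h5 : Nat.centralBinom 14 / (14 + 1) = 2674440 := by decide +kernel
    rw [h5] at h3
    norm_num at h3
  -- The main term is the integral over `[4, ∞)`; the error is the integral over the complement,
  -- where `abs_redPoly_le` applies.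
  refine ⟨fun n => ∫ x in Set.Ici 4, redPoly n x ∂ν, ν.real Set.univ, ν.real (Set.Ici 8), hpos,
    fun n hn => ?_, fun n => ?_, fun n => ?_, fun n => ?_⟩
  · rw [numReduced_eq n hn, ncard_pairsReducedBelow_eq_integral h hν n n le_rfl]
    simp only [Nat.sub_self, pow_zero, one_mul]
    rw [← integral_add_compl (s := Set.Ici (4 : ℝ)) measurableSet_Ici (hint n), add_sub_cancel_left,
      mul_comm, ← Real.norm_eq_abs]
    refine (norm_setIntegral_le_of_norm_le_const_ae' (C := 5 ^ n) (by simp) ?_).trans ?_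
    · filter_upwards [h] with x hx hx'
      exact abs_redPoly_le x hx.1 (not_le.1 (show ¬ (4 : ℝ) ≤ x from hx')).le n
    · gcongr
      · simp
      · exact Set.subset_univ _
  · rw [← integral_const_mul]
    exact setIntegral_mono_on ((hint n).integrableOn.const_mul _) (hint (n + 1)).integrableOn
      measurableSet_Ici fun x hx => two_mul_redPoly_le hx n
  · rw [← integral_const_mul]
    refine setIntegral_mono_on_ae (hint (n + 1)).integrableOn
      ((hint n).integrableOn.const_mul _) measurableSet_Ici ?_
    filter_upwards [h] with x hx hx'
    exact (redPoly_succ_le hx' n).trans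
      (mul_le_mul_of_nonneg_right hx.2 (redPoly_pos hx' n).le)
  · calc ν.real (Set.Ici 8) * 6 ^ n = ∫ x in Set.Ici 8, 6 ^ n ∂ν := by
          rw [setIntegral_const, smul_eq_mul]
      _ ≤ ∫ x in Set.Ici 8, redPoly n x ∂ν :=
          setIntegral_mono_on (integrable_const _).integrableOn (hint n).integrableOn
            measurableSet_Ici fun x hx => six_pow_le_redPoly hx n
      _ ≤ ∫ x in Set.Ici 4, redPoly n x ∂ν := by
          refine setIntegral_mono_set (hint n).integrableOn ?_ ?_
          · filter_upwards [ae_restrict_mem measurableSet_Ici] with x hx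
            exact (redPoly_pos hx n).le
          · exact LE.le.eventuallyLE (Set.Ici_subset_Ici.2 (by norm_num))

/-- The error `M * 5 ^ n` is eventually below half of `c * 6 ^ n ≤ I n`, so `numReduced n` and `I n`
agree up to a factor 2. The regular growth of `I` is then inherited. -/
theorem exists_numReduced_bounds : ∃ (C : ℝ) (N : ℕ), 0 < C ∧ ∀ n, N ≤ n →
    0 < numReduced n ∧ (numReduced (n + 1) : ℝ) ≤ C * numReduced n ∧
    ((∑ m ∈ Finset.range (n + 1), numReduced m : ℕ) : ℝ) ≤ C * numReduced n := by
  obtain ⟨I, M, c, hc, h1, h2, h3, h4⟩ := exists_numReduced_approx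
  have hlim : ∀ᶠ n : ℕ in atTop, M * (5 / 6 : ℝ) ^ n < c / 2 := by
    have := (tendsto_pow_atTop_nhds_zero_of_lt_one (r := (5 / 6 : ℝ)) (by norm_num)
      (by norm_num)).const_mul M
    rw [mul_zero] at this
    exact this.eventually_lt_const (by positivity)
  obtain ⟨N, hN⟩ := eventually_atTop.1 (hlim.and (eventually_ge_atTop 2))
  have hI : ∀ n, 0 < I n := fun n => lt_of_lt_of_le (by positivity) (h4 n)
  have key : ∀ n, N ≤ n → I n / 2 ≤ numReduced n ∧ (numReduced n : ℝ) ≤ 2 * I n := by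
    intro n hn
    have h5 := (hN n hn).1
    have h6 := abs_le.1 (h1 n (hN n hn).2)
    have h7 := h4 n
    have h8 : M * 5 ^ n ≤ c * 6 ^ n / 2 := by
      rw [div_pow, mul_div_assoc', div_lt_iff₀ (by positivity)] at h5
      linarith
    constructor <;> linarith [hI n]
  set A : ℝ := ((∑ m ∈ Finset.range N, numReduced m : ℕ) : ℝ) with hA
  have hA0 : 0 ≤ A := Nat.cast_nonneg _
  -- The inequality `2 * I n ≤ I (n + 1)` makes the sum geometric; `A` collects the terms before
  -- `N`.
  have hS : ∀ n, N ≤ n → ((∑ m ∈ Finset.range n, numReduced m : ℕ) : ℝ) ≤ A + 2 * I n := by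
    intro n hn
    induction n, hn using Nat.le_induction with
    | base => linarith [hI N]
    | succ n hn ih =>
      rw [Finset.sum_range_succ, Nat.cast_add]
      linarith [(key n hn).2, h2 n]
  -- The constant 64 is `2 * 16 * 2`: two comparisons of `numReduced` with `I` and one step of
  -- growth by at most 16.
  refine ⟨64 + A, N, by positivity, fun n hn => ?_⟩
  have h5 := key n hn
  have h6 : 0 < numReduced n := by
    have : (0 : ℝ) < numReduced n := by linarith [hI n]
    exact_mod_cast this
  have h7 : (1 : ℝ) ≤ numReduced n := by exact_mod_cast h6
  have h8 : A ≤ A * numReduced n := le_mul_of_one_le_right hA0 h7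
  refine ⟨h6, ?_, ?_⟩
  · linarith [(key (n + 1) (by omega)).2, h3 n]
  · linarith [hS (n + 1) (by omega), h3 n]


/-! ### A criterion for positive density -/

theorem setOf_sym_subset {α : Type*} (A : Set α) (k : ℕ) : {t : Sym α k | ∀ p ∈ t, p ∈ A} =
    (Sym.map (Subtype.val : A → α)) '' (Set.univ : Set (Sym A k)) := by
  ext t
  constructor
  · intro ht
    refine ⟨t.attach.map (fun x => ⟨x.1, ht x.1 x.2⟩), trivial, ?_⟩
    simp only [Sym.map_map]
    exact t.attach_map_coe
  · rintro ⟨s, -, rfl⟩ p hp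
    obtain ⟨a, -, rfl⟩ := Sym.mem_map.1 hp
    exact a.2

theorem finite_sym_subset {α : Type*} {A : Set α} (hA : A.Finite) (k : ℕ) :
    {t : Sym α k | ∀ p ∈ t, p ∈ A}.Finite := by
  have := hA.to_subtype
  have := Fintype.ofFinite A
  classical
  rw [setOf_sym_subset]
  exact Set.toFinite _

theorem ncard_sym_subset {α : Type*} (A : Set α) (k : ℕ) :
    {t : Sym α k | ∀ p ∈ t, p ∈ A}.ncard = Nat.multichoose A.ncard k := by
  rw [setOf_sym_subset, Set.ncard_image_of_injective _ (Sym.map_injective Subtype.val_injective k),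
    Set.ncard_univ, Sym.natCard_sym_eq_multichoose, Nat.card_coe_set_eq]

theorem factorial_mul_multichoose (n k : ℕ) :
    k.factorial * Nat.multichoose n k = n.ascFactorial k := by
  rw [Nat.multichoose_eq, Nat.ascFactorial_eq_factorial_mul_choose']

theorem pow_le_factorial_mul_multichoose (n k : ℕ) :
    n ^ k ≤ k.factorial * Nat.multichoose n k := by
  rw [factorial_mul_multichoose]
  exact Nat.pow_succ_le_ascFactorial n k

theorem multichoose_le_pow (n k : ℕ) : Nat.multichoose n k ≤ n ^ k := by
  have := Nat.ascFactorial_le_factorial_mul_pow n k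
  rw [← factorial_mul_multichoose] at this
  exact Nat.le_of_mul_le_mul_left this k.factorial_pos

theorem finite_size_eq (n : ℕ) : {p : ReducedTreePair | p.size = n}.Finite := by
  have hinj : Function.Injective (fun p : ReducedTreePair => (p.source, p.target)) := by
    intro p q h
    rw [Prod.mk.injEq] at h
    exact ReducedTreePair.ext h.1 h.2
  refine Set.Finite.of_finite_image ((pairsReducedBelow_finite n 0).subset ?_) hinj.injOn
  rintro _ ⟨p, hp, rfl⟩
  exact ⟨hp, p.numNodes_eq ▸ hp, by simp⟩

theorem ncard_size_lt (n : ℕ) : {p : ReducedTreePair | p.size < n}.Finite ∧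
    {p : ReducedTreePair | p.size < n}.ncard = ∑ m ∈ Finset.range n, numReduced m := by
  induction n with
  | zero => simp
  | succ n ih =>
    have h : {p : ReducedTreePair | p.size < n + 1} =
        {p : ReducedTreePair | p.size < n} ∪ {p : ReducedTreePair | p.size = n} := by
      ext p
      exact Nat.lt_succ_iff_lt_or_eq
    rw [h, Finset.sum_range_succ, ← ih.2]
    refine ⟨ih.1.union (finite_size_eq n), Set.ncard_union_eq ?_ ih.1 (finite_size_eq n)⟩
    exact Set.disjoint_left.2 fun p hp hp' => (ne_of_lt hp) hp'

theorem ncard_maxSphere_le (k n : ℕ) :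
    (maxSphere k n).ncard ≤ (∑ m ∈ Finset.range (n + 1), numReduced m) ^ k := by
  rw [← (ncard_size_lt (n + 1)).2]
  refine le_trans ?_ (multichoose_le_pow _ k)
  rw [← ncard_sym_subset]
  exact Set.ncard_le_ncard (fun t ht p hp => Nat.lt_succ_of_le (ht.1 p hp))
    (finite_sym_subset (ncard_size_lt (n + 1)).1 k)

/-- Tuples with all entries of size exactly `n` already suffice; at most `k!` ordered tuples give
the same unordered one. -/
theorem pow_le_ncard_maxSphere (k n : ℕ) (hk : 1 ≤ k) :
    numReduced n ^ k ≤ k.factorial * (maxSphere k n).ncard := by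
  refine (pow_le_factorial_mul_multichoose _ k).trans (Nat.mul_le_mul_left _ ?_)
  rw [numReduced, ← ncard_sym_subset]
  refine Set.ncard_le_ncard (fun t ht => ?_) (maxSphere_finite k n)
  have ht' : ∀ p ∈ t, p.size = n := ht
  refine ⟨fun p hp => (ht' p hp).le, ?_⟩
  obtain ⟨k, rfl⟩ := Nat.exists_eq_add_of_le' hk
  obtain ⟨p, hp⟩ := t.exists_mem
  exact ⟨p, hp, ht' p hp⟩

/-- The sphere of radius `n + d` has at most `(C ^ (d + 1) * numReduced n) ^ k` elements: one factor
`C` from the sum over smaller sizes and `d` from the shift. The fixed increase `d` in size is thus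
harmless. -/
theorem inMaxSpec_of_le_ncard {k : ℕ} {H : Type*} [Group H] (d : ℕ) {c : ℝ} (hc : 0 < c)
    (h : ∀ᶠ n in atTop, c * (numReduced n : ℝ) ^ k ≤
      ((generatingTuples k H ∩ maxSphere k (n + d)).ncard : ℝ)) : InMaxSpec k H := by
  obtain ⟨C, N, hC, hb⟩ := exists_numReduced_bounds
  obtain ⟨N', hN'⟩ := eventually_atTop.1 h
  have hshift : ∀ d n, N ≤ n → (numReduced (n + d) : ℝ) ≤ C ^ d * numReduced n := by
    intro d n hn
    induction d with
    | zero => simp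
    | succ d ih =>
      calc (numReduced (n + (d + 1)) : ℝ) ≤ C * numReduced (n + d) := (hb (n + d) (by omega)).2.1
        _ ≤ C * (C ^ d * numReduced n) := by gcongr
        _ = _ := by ring
  -- A real `liminf` can be bounded below by an eventual lower bound only if it is not a default
  -- value; the quotients never exceed 1, which supplies the missing bound.
  refine lt_of_lt_of_le (b := c / (C ^ (d + 1)) ^ k) (by positivity)
    (le_liminf_of_le (IsCoboundedUnder.of_frequently_le (a := 1) (Frequently.of_forall fun n => ?_))
      ?_)
  · refine div_le_one_of_le₀ ?_ (Nat.cast_nonneg _)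
    exact_mod_cast Set.ncard_le_ncard Set.inter_subset_right (maxSphere_finite k n)
  · filter_upwards [eventually_ge_atTop (N + N' + d)] with m hm
    obtain ⟨n, rfl⟩ := Nat.exists_eq_add_of_le' (show d ≤ m by omega)
    have h1 := hN' n (by omega)
    have h2 : (0 : ℝ) < numReduced n := by exact_mod_cast (hb n (by omega)).1
    have h3 : ((maxSphere k (n + d)).ncard : ℝ) ≤ (C ^ (d + 1) * numReduced n) ^ k := by
      calc ((maxSphere k (n + d)).ncard : ℝ)
          ≤ ((∑ m ∈ Finset.range (n + d + 1), numReduced m : ℕ) : ℝ) ^ k := by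
            exact_mod_cast ncard_maxSphere_le k (n + d)
        _ ≤ (C * numReduced (n + d)) ^ k :=
            pow_le_pow_left₀ (Nat.cast_nonneg _) (hb (n + d) (by omega)).2.2 k
        _ ≤ (C ^ (d + 1) * numReduced n) ^ k := by
            refine pow_le_pow_left₀ (by positivity) ?_ k
            have := mul_le_mul_of_nonneg_left (hshift d n (by omega)) hC.le
            rw [pow_succ]
            linarith
    have h4 : (0 : ℝ) < (generatingTuples k H ∩ maxSphere k (n + d)).ncard :=
      lt_of_lt_of_le (by positivity) h1
    have h5 : (0 : ℝ) < (maxSphere k (n + d)).ncard := by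
      refine lt_of_lt_of_le h4 ?_
      exact_mod_cast Set.ncard_le_ncard Set.inter_subset_right (maxSphere_finite k _)
    rw [le_div_iff₀ h5, div_mul_eq_mul_div, div_le_iff₀ (by positivity)]
    rw [mul_pow] at h3
    calc c * ((maxSphere k (n + d)).ncard : ℝ) ≤ c * ((C ^ (d + 1)) ^ k * numReduced n ^ k) := by
          gcongr
      _ = c * numReduced n ^ k * (C ^ (d + 1)) ^ k := by ring
      _ ≤ _ := by gcongr

theorem InMaxSpec.le_ncard {k : ℕ} {H : Type*} [Group H] (hk : 1 ≤ k) (h : InMaxSpec k H) :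
    ∃ c : ℝ, 0 < c ∧ ∀ᶠ n in atTop, c * (numReduced n : ℝ) ^ k ≤
      ((generatingTuples k H ∩ maxSphere k n).ncard : ℝ) := by
  have h' : 0 < maxLowerDensity k (generatingTuples k H) := h
  set δ := maxLowerDensity k (generatingTuples k H) with hδ
  have h1 := eventually_lt_of_lt_liminf (show δ / 2 < maxLowerDensity k (generatingTuples k H) by
    linarith) (isBoundedUnder_of ⟨0, fun n => by positivity⟩)
  refine ⟨δ / 2 / k.factorial, by positivity, h1.mono fun n hn => ?_⟩
  have h2 : (numReduced n : ℝ) ^ k ≤ k.factorial * (maxSphere k n).ncard := by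
    exact_mod_cast pow_le_ncard_maxSphere k n hk
  have h3 : 0 < ((maxSphere k n).ncard : ℝ) := by
    -- An empty sphere would give the quotient 0 by convention, contradicting the positive lower
    -- bound.
    rcases (Nat.cast_nonneg (α := ℝ) (maxSphere k n).ncard).eq_or_lt with h3 | h3
    · rw [← h3, div_zero] at hn
      linarith
    · exact h3
  rw [lt_div_iff₀ h3] at hn
  calc δ / 2 / k.factorial * (numReduced n : ℝ) ^ k
      ≤ δ / 2 / k.factorial * (k.factorial * (maxSphere k n).ncard) := by gcongr
    _ = δ / 2 * (maxSphere k n).ncard := by field_simp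
    _ ≤ _ := hn.le

theorem InMaxSpec.congr {k : ℕ} {H : Type*} {H' : Type*} [Group H] [Group H'] (e : H ≃* H')
    (h : InMaxSpec k H) : InMaxSpec k H' := by
  have : generatingTuples k H = generatingTuples k H' := by
    ext t
    exact ⟨fun ⟨f⟩ => ⟨f.trans e⟩, fun ⟨f⟩ => ⟨f.trans e.symm⟩⟩
  unfold InMaxSpec at *
  rwa [← this]


/-! ### Juxtaposition of two homeomorphisms of the unit interval -/

/-- The affine map of `[0,1]` onto `[0,1/2]`. -/
noncomputable def lowerHalf (x : unitInterval) : unitInterval :=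
  ⟨x / 2, by linarith [x.2.1], by linarith [x.2.2]⟩

/-- The affine map of `[0,1]` onto `[1/2,1]`. -/
noncomputable def upperHalf (x : unitInterval) : unitInterval :=
  ⟨(1 + x) / 2, by linarith [x.2.1], by linarith [x.2.2]⟩

theorem coe_lowerHalf (x : unitInterval) : (lowerHalf x : ℝ) = x / 2 := rfl

theorem coe_upperHalf (x : unitInterval) : (upperHalf x : ℝ) = (1 + x) / 2 := rfl

theorem lowerHalf_le_iff {x y : unitInterval} : lowerHalf x ≤ lowerHalf y ↔ x ≤ y := by
  rw [← Subtype.coe_le_coe, ← Subtype.coe_le_coe, coe_lowerHalf, coe_lowerHalf]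
  constructor <;> intro h <;> linarith

theorem upperHalf_le_iff {x y : unitInterval} : upperHalf x ≤ upperHalf y ↔ x ≤ y := by
  rw [← Subtype.coe_le_coe, ← Subtype.coe_le_coe, coe_upperHalf, coe_upperHalf]
  constructor <;> intro h <;> linarith

theorem lowerHalf_le_upperHalf (x y : unitInterval) : lowerHalf x ≤ upperHalf y := by
  rw [← Subtype.coe_le_coe, coe_lowerHalf, coe_upperHalf]
  linarith [x.2.2, y.2.1]

theorem lowerHalf_injective : Function.Injective lowerHalf := fun _ _ h =>
  le_antisymm (lowerHalf_le_iff.1 h.le) (lowerHalf_le_iff.1 h.ge)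

theorem upperHalf_injective : Function.Injective upperHalf := fun _ _ h =>
  le_antisymm (upperHalf_le_iff.1 h.le) (upperHalf_le_iff.1 h.ge)

theorem upperHalf_le_lowerHalf {x y : unitInterval} (h : upperHalf x ≤ lowerHalf y) :
    x = 0 ∧ y = 1 := by
  rw [← Subtype.coe_le_coe, coe_lowerHalf, coe_upperHalf] at h
  have h1 := x.2.1
  have h2 := y.2.2
  exact ⟨Subtype.ext (show (x : ℝ) = 0 by linarith), Subtype.ext (show (y : ℝ) = 1 by linarith)⟩

theorem lowerHalf_one : lowerHalf 1 = upperHalf 0 :=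
  Subtype.ext (by simp [coe_lowerHalf, coe_upperHalf])

theorem eq_half_cases (x : unitInterval) : (∃ y, x = lowerHalf y) ∨ ∃ y, x = upperHalf y := by
  rcases le_total (x : ℝ) (1 / 2) with h | h
  · exact Or.inl ⟨⟨2 * x, by linarith [x.2.1], by linarith⟩, Subtype.ext (by
      simp [coe_lowerHalf])⟩
  · exact Or.inr ⟨⟨2 * x - 1, by linarith, by linarith [x.2.2]⟩, Subtype.ext (by
      simp [coe_upperHalf])⟩

/-- The map which is a copy of `f` on `[0,1/2]` and a copy of `g` on `[1/2,1]`. -/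
noncomputable def juxtFun (f g : unitInterval → unitInterval) (x : unitInterval) : unitInterval :=
  if (x : ℝ) ≤ 1 / 2 then lowerHalf (f (Set.projIcc 0 1 zero_le_one (2 * (x : ℝ))))
  else upperHalf (g (Set.projIcc 0 1 zero_le_one (2 * (x : ℝ) - 1)))

theorem juxtFun_lowerHalf (f g : unitInterval → unitInterval) (x : unitInterval) :
    juxtFun f g (lowerHalf x) = lowerHalf (f x) := by
  have h : (lowerHalf x : ℝ) ≤ 1 / 2 := by rw [coe_lowerHalf]; linarith [x.2.2]
  have h2 : Set.projIcc 0 1 zero_le_one (2 * (lowerHalf x : ℝ)) = x := by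
    rw [coe_lowerHalf, mul_div_cancel₀ _ two_ne_zero]
    exact Set.projIcc_val zero_le_one x
  rw [juxtFun, if_pos h, h2]

/-- The point `1/2` belongs to both halves; the endpoint conditions make the two prescriptions agree
there. -/
theorem juxtFun_upperHalf {f g : unitInterval → unitInterval} (hf : f 1 = 1) (hg : g 0 = 0)
    (x : unitInterval) : juxtFun f g (upperHalf x) = upperHalf (g x) := by
  rcases eq_or_lt_of_le x.2.1 with h0 | h0
  · have hx : x = 0 := Subtype.ext h0.symm
    rw [hx, ← lowerHalf_one, juxtFun_lowerHalf, hf, hg, lowerHalf_one]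
  · have h : ¬ (upperHalf x : ℝ) ≤ 1 / 2 := by rw [coe_upperHalf]; linarith
    have h2 : Set.projIcc 0 1 zero_le_one (2 * (upperHalf x : ℝ) - 1) = x := by
      rw [coe_upperHalf, mul_div_cancel₀ _ two_ne_zero, add_sub_cancel_left]
      exact Set.projIcc_val zero_le_one x
    rw [juxtFun, if_neg h, h2]

theorem orderIso_zero (f : unitInterval ≃o unitInterval) : f 0 = 0 := f.map_bot

theorem orderIso_one (f : unitInterval ≃o unitInterval) : f 1 = 1 := f.map_top

theorem juxtFun_monotone (f g : unitInterval ≃o unitInterval) : Monotone (juxtFun f g) := by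
  intro x y h
  have hu := juxtFun_upperHalf (orderIso_one f) (orderIso_zero g)
  rcases eq_half_cases x with ⟨x, rfl⟩ | ⟨x, rfl⟩ <;> rcases eq_half_cases y with ⟨y, rfl⟩ | ⟨y, rfl⟩
  · rw [juxtFun_lowerHalf, juxtFun_lowerHalf]
    exact lowerHalf_le_iff.2 (f.monotone (lowerHalf_le_iff.1 h))
  · rw [juxtFun_lowerHalf, hu]
    exact lowerHalf_le_upperHalf _ _
  · obtain ⟨rfl, rfl⟩ := upperHalf_le_lowerHalf h
    rw [juxtFun_lowerHalf, hu, orderIso_zero, orderIso_one, lowerHalf_one]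
  · rw [hu, hu]
    exact upperHalf_le_iff.2 (g.monotone (upperHalf_le_iff.1 h))

theorem juxtFun_leftInverse (f g : unitInterval ≃o unitInterval) :
    Function.LeftInverse (juxtFun f.symm g.symm) (juxtFun f g) := by
  intro x
  rcases eq_half_cases x with ⟨x, rfl⟩ | ⟨x, rfl⟩
  · rw [juxtFun_lowerHalf, juxtFun_lowerHalf, f.symm_apply_apply]
  · rw [juxtFun_upperHalf (orderIso_one f) (orderIso_zero g),
      juxtFun_upperHalf (orderIso_one f.symm) (orderIso_zero g.symm), g.symm_apply_apply]

/-- Juxtaposition: `f` on `[0,1/2]` and `g` on `[1/2,1]`. -/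
noncomputable def juxt (f g : unitInterval ≃o unitInterval) : unitInterval ≃o unitInterval :=
  Equiv.toOrderIso ⟨juxtFun f g, juxtFun f.symm g.symm, juxtFun_leftInverse f g,
    juxtFun_leftInverse f.symm g.symm⟩ (juxtFun_monotone f g) (juxtFun_monotone f.symm g.symm)

theorem juxt_lowerHalf (f g : unitInterval ≃o unitInterval) (x : unitInterval) :
    juxt f g (lowerHalf x) = lowerHalf (f x) := juxtFun_lowerHalf f g x

theorem juxt_upperHalf (f g : unitInterval ≃o unitInterval) (x : unitInterval) :
    juxt f g (upperHalf x) = upperHalf (g x) :=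
  juxtFun_upperHalf (orderIso_one f) (orderIso_zero g) x

theorem eq_juxt {h f g : unitInterval ≃o unitInterval}
    (hl : ∀ x, h (lowerHalf x) = lowerHalf (f x)) (hu : ∀ x, h (upperHalf x) = upperHalf (g x)) :
    h = juxt f g := by
  ext x
  rcases eq_half_cases x with ⟨x, rfl⟩ | ⟨x, rfl⟩
  · rw [hl, juxt_lowerHalf]
  · rw [hu, juxt_upperHalf]

/-- Juxtaposition as a homomorphism. -/
noncomputable def juxtHom : (unitInterval ≃o unitInterval) × (unitInterval ≃o unitInterval) →*
    (unitInterval ≃o unitInterval) where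
  toFun q := juxt q.1 q.2
  map_one' := (eq_juxt (fun _ => rfl) fun _ => rfl).symm
  map_mul' p q := (eq_juxt (fun x => by
    rw [RelIso.mul_apply, juxt_lowerHalf, juxt_lowerHalf]; rfl) fun x => by
    rw [RelIso.mul_apply, juxt_upperHalf, juxt_upperHalf]; rfl).symm

theorem juxtHom_apply (f g : unitInterval ≃o unitInterval) : juxtHom (f, g) = juxt f g := rfl

theorem juxtHom_injective : Function.Injective juxtHom := by
  rintro ⟨f, g⟩ ⟨f', g'⟩ h
  rw [juxtHom_apply, juxtHom_apply] at h
  refine Prod.ext (RelIso.ext fun x => lowerHalf_injective ?_)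
    (RelIso.ext fun x => upperHalf_injective ?_)
  · rw [← juxt_lowerHalf f g, ← juxt_lowerHalf f' g', h]
  · rw [← juxt_upperHalf f g, ← juxt_upperHalf f' g', h]

theorem juxt_one : juxt 1 1 = 1 := juxtHom.map_one

theorem juxt_mul (f g f' g' : unitInterval ≃o unitInterval) :
    juxt f g * juxt f' g' = juxt (f * f') (g * g') := (juxtHom.map_mul (f, g) (f', g')).symm

theorem juxt_inv (f g : unitInterval ≃o unitInterval) : (juxt f g)⁻¹ = juxt f⁻¹ g⁻¹ :=
  (juxtHom.map_inv (f, g)).symm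

/-! ### Tree pair maps: composition and juxtaposition -/

theorem numLeaves_eq_of_numNodes_eq {S T : BinaryTree Unit} (h : S.numNodes = T.numNodes) :
    S.numLeaves = T.numLeaves := by
  rw [S.numLeaves_eq_numNodes_succ, T.numLeaves_eq_numNodes_succ, h]

theorem leafCoord_zero (T : BinaryTree Unit) : leafCoord T 0 = 0 := by
  have := leafCoord_leafPoint T 0 le_rfl (Nat.cast_nonneg _)
  rwa [leafPoint_zero] at this

theorem leafCoord_one (T : BinaryTree Unit) : leafCoord T 1 = T.numLeaves := by
  have := leafCoord_leafPoint T T.numLeaves (Nat.cast_nonneg _) le_rfl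
  rwa [leafPoint_numLeaves] at this

theorem leafCoord_node_lowerHalf (l r : BinaryTree Unit) (x : unitInterval) :
    leafCoord (.node () l r) (lowerHalf x) = leafCoord l x := by
  rw [coe_lowerHalf, leafCoord, if_pos (by linarith [x.2.2])]
  congr 1
  ring

theorem leafCoord_node_upperHalf (l r : BinaryTree Unit) (x : unitInterval) :
    leafCoord (.node () l r) (upperHalf x) = l.numLeaves + leafCoord r x := by
  rw [coe_upperHalf, leafCoord]
  split_ifs with h
  · have hx : (x : ℝ) = 0 := le_antisymm (by linarith) x.2.1
    rw [hx, leafCoord_zero, show (2 : ℝ) * ((1 + 0) / 2) = 1 by norm_num, leafCoord_one, add_zero]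
  · congr 2
    ring

theorem leafPoint_node_add (l r : BinaryTree Unit) (y : ℝ) (hy : 0 ≤ y) :
    leafPoint (.node () l r) (l.numLeaves + y) = (1 + leafPoint r y) / 2 := by
  rw [leafPoint]
  split_ifs with h
  · have hx : y = 0 := le_antisymm (by linarith) hy
    rw [hx, add_zero, leafPoint_numLeaves, leafPoint_zero]
    ring
  · rw [add_sub_cancel_left]

theorem treePairMap_self (S : BinaryTree Unit) (h : S.numNodes = S.numNodes) :
    treePairMap S S h = 1 := by
  ext x
  exact leafPoint_leafCoord S x x.2.1 x.2.2

theorem treePairMap_mul (S T U : BinaryTree Unit) (h : S.numNodes = T.numNodes)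
    (h' : T.numNodes = U.numNodes) :
    treePairMap T U h' * treePairMap S T h = treePairMap S U (h.trans h') := by
  ext x
  rw [RelIso.mul_apply, treePairMap_apply, treePairMap_apply, treePairMap_apply]
  have h1 := leafCoord_mem S x x.2.1 x.2.2
  rw [leafCoord_leafPoint T _ h1.1 (numLeaves_eq_of_numNodes_eq h ▸ h1.2)]

theorem treePairMap_inv (S T : BinaryTree Unit) (h : S.numNodes = T.numNodes) :
    (treePairMap S T h)⁻¹ = treePairMap T S h.symm :=
  inv_eq_of_mul_eq_one_left (by rw [treePairMap_mul, treePairMap_self])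

theorem treePairMap_node {l r l' r' : BinaryTree Unit} (hl : l.numNodes = l'.numNodes)
    (hr : r.numNodes = r'.numNodes)
    (h : (BinaryTree.node () l r).numNodes = (BinaryTree.node () l' r').numNodes) :
    treePairMap (.node () l r) (.node () l' r') h =
      juxt (treePairMap l l' hl) (treePairMap r r' hr) := by
  refine eq_juxt (fun x => ?_) fun x => ?_
  · ext
    rw [treePairMap_apply, leafCoord_node_lowerHalf, coe_lowerHalf, treePairMap_apply, leafPoint,
      if_pos]
    rw [← numLeaves_eq_of_numNodes_eq hl]
    exact (leafCoord_mem l x x.2.1 x.2.2).2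
  · ext
    rw [treePairMap_apply, leafCoord_node_upperHalf, coe_upperHalf, treePairMap_apply,
      numLeaves_eq_of_numNodes_eq hl, leafPoint_node_add _ _ _ (leafCoord_mem r x x.2.1 x.2.2).1]


/-! ### Operations on reduced tree pairs -/

/-- The empty tree if the given tree is a single caret, and the tree itself otherwise. -/
def stripCaret (T : BinaryTree Unit) : BinaryTree Unit := if T.numNodes = 1 then .nil else T

theorem eq_nil_of_numNodes {T : BinaryTree Unit} (h : T.numNodes = 0) : T = .nil := by
  cases T with
  | nil => rfl
  | node u l r => simp at h

theorem eq_caret_of_numNodes {T : BinaryTree Unit} (h : T.numNodes = 1) :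
    T = .node () .nil .nil := by
  cases T with
  | nil => simp at h
  | node u l r =>
    simp only [BinaryTree.numNodes] at h
    rw [eq_nil_of_numNodes (T := l) (by omega), eq_nil_of_numNodes (T := r) (by omega)]

theorem numNodes_stripCaret {S T : BinaryTree Unit} (h : S.numNodes = T.numNodes) :
    (stripCaret S).numNodes = (stripCaret T).numNodes := by
  unfold stripCaret
  rw [h]
  split_ifs
  · rfl
  · exact h

theorem numNodes_stripCaret_le (S : BinaryTree Unit) :
    (stripCaret S).numNodes ≤ S.numNodes := by
  unfold stripCaret
  split_ifs
  · simp
  · rfl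

theorem stripCaret_of_two_le {S : BinaryTree Unit} (h : 2 ≤ S.numNodes) : stripCaret S = S :=
  if_neg (by omega)

theorem stripCaret_inj {S T : BinaryTree Unit} (hS : 1 ≤ S.numNodes) (hT : 1 ≤ T.numNodes)
    (h : stripCaret S = stripCaret T) : S = T := by
  unfold stripCaret at h
  split_ifs at h with h1 h2 h2
  · rw [eq_caret_of_numNodes h1, eq_caret_of_numNodes h2]
  · rw [← h] at hT; simp at hT
  · rw [h] at hS; simp at hS
  · exact h

namespace ReducedTreePair

theorem nonempty_target (p : ReducedTreePair) : 1 ≤ p.target.numNodes :=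
  p.numNodes_eq ▸ p.nonempty

/-- The homeomorphism of the unit interval represented by a reduced tree pair. -/
noncomputable def toHomeo (p : ReducedTreePair) : unitInterval ≃o unitInterval :=
  treePairMap p.source p.target p.numNodes_eq

theorem numNodes_strip (p : ReducedTreePair) :
    (stripCaret p.source).numNodes = (stripCaret p.target).numNodes :=
  numNodes_stripCaret p.numNodes_eq

/-- Grafting the pair of single carets would create a common exposed caret. Grafting the empty pair
instead represents the same element and keeps the result reduced. -/
theorem toHomeo_eq_strip (p : ReducedTreePair) :
    p.toHomeo = treePairMap (stripCaret p.source) (stripCaret p.target) p.numNodes_strip := by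
  by_cases h : p.source.numNodes = 1
  · have hs := eq_caret_of_numNodes h
    have ht := eq_caret_of_numNodes (p.numNodes_eq ▸ h)
    unfold toHomeo
    simp only [hs, ht]
    rw [treePairMap_self, treePairMap_self]
  · unfold toHomeo stripCaret
    simp only [if_neg h, if_neg (p.numNodes_eq ▸ h)]

theorem strip_reduced (p : ReducedTreePair) (i : ℕ) :
    ¬ (HasExposedCaret (stripCaret p.source) i ∧ HasExposedCaret (stripCaret p.target) i) := by
  unfold stripCaret
  rcases p.reduced with h | h
  · rw [if_pos h]
    exact fun h => h.1
  · by_cases h1 : p.source.numNodes = 1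
    · rw [if_pos h1]
      exact fun h => h.1
    · rw [if_neg h1, if_neg (p.numNodes_eq ▸ h1)]
      exact h i

theorem ext_strip {p q : ReducedTreePair} (hs : stripCaret p.source = stripCaret q.source)
    (ht : stripCaret p.target = stripCaret q.target) : p = q :=
  ReducedTreePair.ext (stripCaret_inj p.nonempty q.nonempty hs)
    (stripCaret_inj p.nonempty_target q.nonempty_target ht)

/-- The pair of single carets, which represents the identity. -/
def idPair : ReducedTreePair :=
  ⟨.node () .nil .nil, .node () .nil .nil, rfl, by simp, Or.inl (by simp)⟩

theorem toHomeo_idPair : idPair.toHomeo = 1 := treePairMap_self _ _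

theorem stripCaret_idPair : stripCaret idPair.source = .nil := rfl

/-- The reduced pair which represents the juxtaposition of two elements. -/
def join (p q : ReducedTreePair) : ReducedTreePair where
  source := .node () (stripCaret p.source) (stripCaret q.source)
  target := .node () (stripCaret p.target) (stripCaret q.target)
  numNodes_eq := by simp [p.numNodes_strip, q.numNodes_strip]
  nonempty := by simp
  reduced := by
    have hp := numLeaves_eq_of_numNodes_eq p.numNodes_strip
    -- If both grafted trees are empty, the result is the pair of single carets, reduced by
    -- convention.
    by_cases h0 : (stripCaret p.source).numNodes = 0 ∧ (stripCaret q.source).numNodes = 0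
    · left
      simp [h0.1, h0.2]
    right
    rintro i ⟨h1, h2⟩
    rcases h1 with ⟨h3, h4, -⟩ | h1 | ⟨j, rfl, h1⟩
    · exact h0 ⟨by rw [h3]; rfl, by rw [h4]; rfl⟩
    · rcases h2 with ⟨h3, h4, -⟩ | h2 | ⟨j, rfl, h2⟩
      · exact h0 ⟨by rw [p.numNodes_strip, h3]; rfl, by rw [q.numNodes_strip, h4]; rfl⟩
      · exact p.strip_reduced i ⟨h1, h2⟩
      · have := hasExposedCaret_lt h1
        omega
    · rcases h2 with ⟨h3, h4, -⟩ | h2 | ⟨j', hj, h2⟩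
      · exact h0 ⟨by rw [p.numNodes_strip, h3]; rfl, by rw [q.numNodes_strip, h4]; rfl⟩
      · have := hasExposedCaret_lt h2
        omega
      · obtain rfl : j = j' := by omega
        exact q.strip_reduced j ⟨h1, h2⟩

theorem toHomeo_join (p q : ReducedTreePair) :
    (join p q).toHomeo = juxt p.toHomeo q.toHomeo := by
  rw [toHomeo_eq_strip p, toHomeo_eq_strip q]
  exact treePairMap_node p.numNodes_strip q.numNodes_strip _

theorem join_inj {p q p' q' : ReducedTreePair} (h : join p q = join p' q') : p = p' ∧ q = q' := by
  have h1 := congrArg source h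
  have h2 := congrArg target h
  simp only [join, BinaryTree.node.injEq, true_and] at h1 h2
  exact ⟨ext_strip h1.1 h2.1, ext_strip h1.2 h2.2⟩

theorem size_join (p q : ReducedTreePair) (hp : 2 ≤ p.size) (hq : 2 ≤ q.size) :
    (join p q).size = p.size + q.size + 1 := by
  simp only [size, join, BinaryTree.numNodes] at *
  rw [stripCaret_of_two_le hp, stripCaret_of_two_le hq]

/-- A copy of a pair supported in `[0,1/2]`. -/
def lower (p : ReducedTreePair) : ReducedTreePair := join p idPair

/-- A copy of a pair supported in `[1/2,1]`. -/
def upper (p : ReducedTreePair) : ReducedTreePair := join idPair p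

theorem toHomeo_lower (p : ReducedTreePair) : p.lower.toHomeo = juxt p.toHomeo 1 := by
  rw [lower, toHomeo_join, toHomeo_idPair]

theorem toHomeo_upper (p : ReducedTreePair) : p.upper.toHomeo = juxt 1 p.toHomeo := by
  rw [upper, toHomeo_join, toHomeo_idPair]

theorem lower_injective : Function.Injective lower := fun _ _ h => (join_inj h).1

theorem upper_injective : Function.Injective upper := fun _ _ h => (join_inj h).2

theorem size_lower (p : ReducedTreePair) (hp : 2 ≤ p.size) : p.lower.size = p.size + 1 := by
  simp only [size, lower, join, BinaryTree.numNodes, stripCaret_idPair] at *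
  rw [stripCaret_of_two_le hp]

theorem size_upper (p : ReducedTreePair) (hp : 2 ≤ p.size) : p.upper.size = p.size + 1 := by
  simp only [size, upper, join, BinaryTree.numNodes, stripCaret_idPair] at *
  rw [stripCaret_of_two_le hp, zero_add]

theorem size_lower_le (p : ReducedTreePair) : p.lower.size ≤ p.size + 1 := by
  have h1 := numNodes_stripCaret_le p.source
  simp only [size, lower, join, BinaryTree.numNodes, stripCaret_idPair] at *
  omega

theorem size_upper_le (p : ReducedTreePair) : p.upper.size ≤ p.size + 1 := by
  have h1 := numNodes_stripCaret_le p.source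
  simp only [size, upper, join, BinaryTree.numNodes, stripCaret_idPair] at *
  omega

/-- The reduced pair obtained from the rotation of a tree with two carets by putting a copy of a
reduced pair at the last leaf. -/
def rotation (p : ReducedTreePair) : ReducedTreePair where
  source := .node () (.node () .nil .nil) (stripCaret p.source)
  target := .node () .nil (.node () .nil (stripCaret p.target))
  numNodes_eq := by simp [p.numNodes_strip]; omega
  nonempty := by simp
  reduced := by
    right
    rintro i ⟨h1, h2⟩
    simp only [HasExposedCaret, BinaryTree.numLeaves] at h1 h2
    rcases h1 with ⟨h3, -, -⟩ | (⟨-, -, rfl⟩ | h | ⟨_, -, h⟩) | ⟨j, rfl, h1⟩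
    · cases h3
    · rcases h2 with ⟨-, h3, -⟩ | h | ⟨j, h3, -⟩
      · cases h3
      · exact h
      · omega
    · exact h
    · exact h
    · rcases h2 with ⟨-, h3, -⟩ | h | ⟨j', hj, ⟨-, h3, h4⟩ | h | ⟨j'', hj', h2⟩⟩
      · cases h3
      · exact h
      · omega
      · exact h
      · obtain rfl : j = j'' := by omega
        exact p.strip_reduced j ⟨h1, h2⟩

theorem rotation_injective : Function.Injective rotation := by
  intro p q h
  have h1 := congrArg source h
  have h2 := congrArg target h
  simp only [rotation, BinaryTree.node.injEq, true_and] at h1 h2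
  exact ext_strip h1 h2

theorem size_rotation (p : ReducedTreePair) (hp : 2 ≤ p.size) : p.rotation.size = p.size + 2 := by
  simp only [size, rotation, BinaryTree.numNodes] at *
  rw [stripCaret_of_two_le hp]
  omega

theorem rotation_ne_lower (p q : ReducedTreePair) : p.rotation ≠ q.lower := by
  intro h
  have h2 := congrArg target h
  simp [rotation, lower, join, stripCaret_idPair] at h2
  exact absurd h2.2 (by rw [show stripCaret idPair.target = .nil from rfl]; simp)

/-- The grafted pair sits at the last leaf and does not influence the image of `1/4`. This is all
that displacing `[1/4,1/2)` requires. -/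
theorem toHomeo_rotation_quarter (p : ReducedTreePair) :
    p.rotation.toHomeo (lowerHalf (upperHalf 0)) = upperHalf 0 := by
  ext
  simp only [toHomeo, treePairMap_apply, rotation]
  rw [leafCoord_node_lowerHalf, leafCoord_node_upperHalf]
  simp [leafCoord, leafPoint, coe_upperHalf]

end ReducedTreePair


/-! ### Families of large finite sets -/

/-- The finite sets `B n` have at least the order of magnitude of the `a`-th power of the number of
reduced pairs of size `n`. -/
def IsLarge {β : Type*} (a : ℕ) (B : ℕ → Set β) : Prop :=
  ∃ c : ℝ, 0 < c ∧ ∀ᶠ n in atTop, c * (numReduced n : ℝ) ^ a ≤ ((B n).ncard : ℝ)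

theorem InMaxSpec.isLarge {k : ℕ} {H : Type*} [Group H] (hk : 1 ≤ k) (h : InMaxSpec k H) :
    IsLarge k fun n => generatingTuples k H ∩ maxSphere k n := h.le_ncard hk

theorem isLarge_sym (k : ℕ) :
    IsLarge k fun n => {t : Sym ReducedTreePair k | ∀ p ∈ t, p ∈ {p | p.size = n}} := by
  refine ⟨1 / k.factorial, by positivity, Eventually.of_forall fun n => ?_⟩
  have h : (numReduced n : ℝ) ^ k ≤ k.factorial * Nat.multichoose (numReduced n) k := by
    exact_mod_cast pow_le_factorial_mul_multichoose (numReduced n) k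
  rw [ncard_sym_subset, one_div_mul_eq_div, div_le_iff₀' (by positivity)]
  exact h

theorem IsLarge.prod {β : Type*} {a : ℕ} {B : ℕ → Set β} (h : IsLarge a B) :
    IsLarge (a + 1) fun n => B n ×ˢ {p : ReducedTreePair | p.size = n} := by
  obtain ⟨c, hc, h⟩ := h
  refine ⟨c, hc, h.mono fun n hn => ?_⟩
  rw [Set.ncard_prod, Nat.cast_mul, pow_succ, ← mul_assoc]
  exact mul_le_mul_of_nonneg_right hn (Nat.cast_nonneg _)

/-- The form in which the density criterion is applied: `B n` is the parameter set, `f` the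
construction, and `d` the number of carets by which it enlarges pairs. -/
theorem IsLarge.inMaxSpec {β : Type*} {k : ℕ} {B : ℕ → Set β} (h : IsLarge k B) {H : Type*}
    [Group H] (d : ℕ) (f : β → Sym ReducedTreePair k)
    (hmaps : ∀ n, 2 ≤ n → ∀ b ∈ B n, f b ∈ generatingTuples k H ∩ maxSphere k (n + d))
    (hinj : ∀ n, 2 ≤ n → Set.InjOn f (B n)) : InMaxSpec k H := by
  obtain ⟨c, hc, h⟩ := h
  refine inMaxSpec_of_le_ncard d hc ?_
  filter_upwards [h, eventually_ge_atTop 2] with n hn h2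
  refine hn.trans ?_
  exact_mod_cast Set.ncard_le_ncard_of_injOn f (hmaps n h2) (hinj n h2)
    ((maxSphere_finite k (n + d)).subset Set.inter_subset_right)

/-- Tuples are unordered, so a new entry can be recovered only when its shape differs from that of
all remaining entries. The various lemmas separating shapes serve this purpose. -/
theorem sym_cons_inj {α : Type*} {k : ℕ} {a a' : α} {s s' : Sym α k}
    (h : a ::ₛ s = a' ::ₛ s') (ha : a ∉ s') : a = a' ∧ s = s' := by
  have h1 : a ∈ a' ::ₛ s' := h ▸ Sym.mem_cons_self a s
  obtain rfl := (Sym.mem_cons.1 h1).resolve_right ha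
  exact ⟨rfl, (Sym.cons_inj_right _ _ _).1 h⟩

theorem cons_mem_maxSphere {k n : ℕ} {a : ReducedTreePair} {t : Sym ReducedTreePair k}
    (ha : a.size = n) (ht : ∀ p ∈ t, p.size ≤ n) : a ::ₛ t ∈ maxSphere (k + 1) n := by
  refine ⟨fun p hp => ?_, a, Sym.mem_cons_self _ _, ha⟩
  rcases Sym.mem_cons.1 hp with rfl | hp
  · exact ha.le
  · exact ht p hp

/-! ### The group of homeomorphisms generated by a tuple -/

/-- The group of homeomorphisms of the unit interval generated by a tuple of reduced pairs. -/
noncomputable def generated {k : ℕ} (t : Sym ReducedTreePair k) :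
    Subgroup (unitInterval ≃o unitInterval) :=
  Subgroup.closure (ReducedTreePair.toHomeo '' {p | p ∈ t})

/-- The generated group may be computed among all homeomorphisms, since the inclusion of `F` is
injective. -/
theorem mem_generatingTuples {k : ℕ} {H : Type*} [Group H] {t : Sym ReducedTreePair k} :
    t ∈ generatingTuples k H ↔ Nonempty (generated t ≃* H) := by
  have h : generated t =
      (Subgroup.closure {f : F | ∃ p ∈ t, p.toF = f}).map F.subtype := by
    rw [MonoidHom.map_closure, generated]
    congr 1
    ext f
    constructor
    · rintro ⟨p, hp, rfl⟩
      exact ⟨p.toF, ⟨p, hp, rfl⟩, rfl⟩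
    · rintro ⟨_, ⟨p, hp, rfl⟩, rfl⟩
      exact ⟨p, hp, rfl⟩
  have e : Subgroup.closure {f : F | ∃ p ∈ t, p.toF = f} ≃* generated t :=
    (Subgroup.equivMapOfInjective _ F.subtype F.subtype_injective).trans
      (MulEquiv.subgroupCongr h.symm)
  exact ⟨fun ⟨f⟩ => ⟨e.symm.trans f⟩, fun ⟨f⟩ => ⟨e.trans f⟩⟩

theorem generated_cons {k : ℕ} (a : ReducedTreePair) (t : Sym ReducedTreePair k) :
    generated (a ::ₛ t) = Subgroup.zpowers a.toHomeo ⊔ generated t := by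
  have h : {p | p ∈ a ::ₛ t} = {a} ∪ {p | p ∈ t} := by
    ext p
    simp [Sym.mem_cons]
  rw [generated, h, Set.image_union, Subgroup.closure_union, Set.image_singleton,
    Subgroup.zpowers_eq_closure, generated]

theorem generated_nil : generated (Sym.nil : Sym ReducedTreePair 0) = ⊥ := by
  rw [generated, Subgroup.closure_eq_bot_iff]
  rintro _ ⟨p, hp, -⟩
  simp at hp

theorem generated_map {k : ℕ} (t : Sym ReducedTreePair k) (φ : ReducedTreePair → ReducedTreePair)
    (Φ : (unitInterval ≃o unitInterval) →* (unitInterval ≃o unitInterval))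
    (h : ∀ p, (φ p).toHomeo = Φ p.toHomeo) : generated (t.map φ) = (generated t).map Φ := by
  rw [generated, generated, MonoidHom.map_closure]
  congr 1
  ext f
  constructor
  · rintro ⟨_, hq, rfl⟩
    obtain ⟨p, hp, rfl⟩ := Sym.mem_map.1 hq
    exact ⟨_, ⟨p, hp, rfl⟩, (h p).symm⟩
  · rintro ⟨_, ⟨p, hp, rfl⟩, rfl⟩
    exact ⟨φ p, Sym.mem_map.2 ⟨p, hp, rfl⟩, h p⟩

/-- The homomorphism which puts a copy of a homeomorphism on `[0,1/2]`. -/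
noncomputable def lowerHom : (unitInterval ≃o unitInterval) →* (unitInterval ≃o unitInterval) :=
  juxtHom.comp (MonoidHom.inl _ _)

/-- The homomorphism which puts a copy of a homeomorphism on `[1/2,1]`. -/
noncomputable def upperHom : (unitInterval ≃o unitInterval) →* (unitInterval ≃o unitInterval) :=
  juxtHom.comp (MonoidHom.inr _ _)

theorem map_upperHom_sup_map_lowerHom (K L : Subgroup (unitInterval ≃o unitInterval)) :
    L.map upperHom ⊔ K.map lowerHom = (K.prod L).map juxtHom := by
  have h : K.prod L = L.map (MonoidHom.inr _ _) ⊔ K.map (MonoidHom.inl _ _) := by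
    refine le_antisymm (Subgroup.prod_le_iff.2 ⟨le_sup_right, le_sup_left⟩)
      (sup_le ?_ ?_)
    · rintro _ ⟨g, hg, rfl⟩
      exact ⟨K.one_mem, hg⟩
    · rintro _ ⟨g, hg, rfl⟩
      exact ⟨hg, L.one_mem⟩
  rw [h, Subgroup.map_sup, Subgroup.map_map, Subgroup.map_map]
  rfl

/-- Two groups acting on the two halves of the interval generate their direct product. -/
noncomputable def supMapEquivProd (K L : Subgroup (unitInterval ≃o unitInterval)) :
    (L.map upperHom ⊔ K.map lowerHom : Subgroup (unitInterval ≃o unitInterval)) ≃* K × L :=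
  (MulEquiv.subgroupCongr (map_upperHom_sup_map_lowerHom K L)).trans
    ((Subgroup.equivMapOfInjective _ juxtHom juxtHom_injective).symm.trans (K.prodEquiv L))

/-! ### Infinite order of nontrivial homeomorphisms -/

theorem pow_apply_le_of_le {f : unitInterval ≃o unitInterval} {x : unitInterval} (h : f x ≤ x)
    (n : ℕ) : (f ^ (n + 1)) x ≤ f x := by
  induction n with
  | zero => rw [zero_add, pow_one]
  | succ n ih =>
    rw [pow_succ', RelIso.mul_apply]
    exact f.monotone (ih.trans h)

theorem le_pow_apply_of_le {f : unitInterval ≃o unitInterval} {x : unitInterval} (h : x ≤ f x)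
    (n : ℕ) : f x ≤ (f ^ (n + 1)) x := by
  induction n with
  | zero => rw [zero_add, pow_one]
  | succ n ih =>
    rw [pow_succ', RelIso.mul_apply]
    exact f.monotone (h.trans ih)

/-- By monotonicity the orbit of a moved point keeps moving in one direction and never returns. -/
theorem orderOf_orderIso {f : unitInterval ≃o unitInterval} (hf : f ≠ 1) : orderOf f = 0 := by
  rw [orderOf_eq_zero_iff']
  intro n hn h
  obtain ⟨n, rfl⟩ := Nat.exists_eq_add_of_le' hn
  refine hf (RelIso.ext fun x => ?_)
  have h' : (f ^ (n + 1)) x = x := by rw [h]; rfl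
  rcases le_total (f x) x with hx | hx
  · have := pow_apply_le_of_le hx n
    rw [h'] at this
    exact le_antisymm hx this
  · have := le_pow_apply_of_le hx n
    rw [h'] at this
    exact le_antisymm this hx

theorem nonempty_zpowers_equiv {f : unitInterval ≃o unitInterval} (hf : f ≠ 1) :
    Nonempty (Subgroup.zpowers f ≃* Multiplicative ℤ) := by
  have h : Function.Injective (zpowersHom _ f) := by
    rw [injective_iff_map_eq_one]
    intro n hn
    rw [zpowersHom_apply] at hn
    have := orderOf_eq_zero_iff.1 (orderOf_orderIso hf)
    rw [← injective_zpow_iff_not_isOfFinOrder] at this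
    exact this (hn.trans (zpow_zero f).symm)
  exact ⟨((MonoidHom.ofInjective h).trans (MulEquiv.subgroupCongr (by
    ext g
    exact ⟨fun ⟨a, ha⟩ => ⟨a.toAdd, ha⟩, fun ⟨a, ha⟩ => ⟨Multiplicative.ofAdd a, ha⟩⟩))).symm⟩

/-! ### Reduced pairs with at least two carets are nontrivial -/

/-- The value at 1 is the number of leaves, which separates the empty tree from the others;
restriction to the two halves recovers the subtrees. -/
theorem leafCoord_injective (S : BinaryTree Unit) : ∀ T : BinaryTree Unit,
    (∀ x : unitInterval, leafCoord S x = leafCoord T x) → S = T := by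
  induction S with
  | nil =>
    intro T h
    have h1 := h 1
    rw [show ((1 : unitInterval) : ℝ) = 1 from rfl, leafCoord_one, leafCoord_one] at h1
    have h2 : (BinaryTree.nil : BinaryTree Unit).numLeaves = T.numLeaves := by exact_mod_cast h1
    rw [BinaryTree.numLeaves_eq_numNodes_succ, BinaryTree.numLeaves_eq_numNodes_succ] at h2
    refine (eq_nil_of_numNodes ?_).symm
    simp only [BinaryTree.numNodes] at h2
    omega
  | node u l r ihl ihr =>
    intro T h
    cases T with
    | nil =>
      have h1 := h 1
      rw [show ((1 : unitInterval) : ℝ) = 1 from rfl, leafCoord_one, leafCoord_one] at h1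
      have h2 : (BinaryTree.node () l r).numLeaves = (BinaryTree.nil : BinaryTree Unit).numLeaves :=
        by exact_mod_cast h1
      have h3 := l.numLeaves_pos
      have h4 := r.numLeaves_pos
      simp only [BinaryTree.numLeaves] at h2
      omega
    | node u l' r' =>
      have hl := ihl l' fun x => by
        have := h (lowerHalf x)
        rwa [leafCoord_node_lowerHalf, leafCoord_node_lowerHalf] at this
      subst hl
      have hr := ihr r' fun x => by
        have := h (upperHalf x)
        rw [leafCoord_node_upperHalf, leafCoord_node_upperHalf] at this
        linarith
      rw [hr]

theorem exists_hasExposedCaret (T : BinaryTree Unit) (h : T ≠ .nil) :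
    ∃ i, HasExposedCaret T i := by
  induction T with
  | nil => exact absurd rfl h
  | node u l r ihl ihr =>
    by_cases hl : l = .nil
    · by_cases hr : r = .nil
      · exact ⟨0, Or.inl ⟨hl, hr, rfl⟩⟩
      · obtain ⟨i, hi⟩ := ihr hr
        exact ⟨_, Or.inr (Or.inr ⟨i, rfl, hi⟩)⟩
    · obtain ⟨i, hi⟩ := ihl hl
      exact ⟨i, Or.inr (Or.inl hi)⟩

/-- If the map is the identity, the two trees have the same leaf coordinate and coincide. Any
exposed caret is then common to both, against reducedness. -/
theorem ReducedTreePair.toHomeo_ne_one {p : ReducedTreePair} (hp : 2 ≤ p.size) :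
    p.toHomeo ≠ 1 := by
  intro h
  have hp' : 2 ≤ p.source.numNodes := hp
  have hST : p.source = p.target := leafCoord_injective _ _ fun x => by
    have h1 : (p.toHomeo x : ℝ) = x := by rw [h]; rfl
    have h2 := leafCoord_mem p.source x x.2.1 x.2.2
    rw [toHomeo, treePairMap_apply] at h1
    conv_rhs => rw [← h1]
    rw [leafCoord_leafPoint _ _ h2.1 (numLeaves_eq_of_numNodes_eq p.numNodes_eq ▸ h2.2)]
  rcases p.reduced with h1 | h1
  · omega
  · obtain ⟨i, hi⟩ := exists_hasExposedCaret p.source (by rintro h2; rw [h2] at hp'; simp at hp')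
    exact h1 i ⟨hi, hST ▸ hi⟩

/-! ### Direct products with the infinite cyclic group -/

theorem ReducedTreePair.upper_ne_lower {p : ReducedTreePair} (hp : 2 ≤ p.size)
    (q : ReducedTreePair) : p.upper ≠ q.lower := fun h => by
  have h1 := (join_inj h).2
  have h2 : idPair.size = 1 := by simp [size, idPair]
  rw [h1, h2] at hp
  omega

/-- The old entries act on `[0,1/2]` and grow by at most one caret; the new one acts on `[1/2,1]`
and grows by exactly one, so it alone fixes the radius `n + 1`. -/
theorem InMaxSpec.prod_int {k : ℕ} {H : Type*} [Group H] (hk : 1 ≤ k) (h : InMaxSpec k H) :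
    InMaxSpec (k + 1) (H × Multiplicative ℤ) := by
  refine (h.isLarge hk).prod.inMaxSpec 1 (fun b => b.2.upper ::ₛ b.1.map ReducedTreePair.lower)
    (fun n hn b hb => ⟨?_, ?_⟩) ?_
  · obtain ⟨⟨ht, -⟩, hp⟩ := hb
    have hp : b.2.size = n := hp
    rw [mem_generatingTuples] at ht ⊢
    obtain ⟨e⟩ := ht
    obtain ⟨e'⟩ := nonempty_zpowers_equiv (ReducedTreePair.toHomeo_ne_one (hn.trans hp.ge))
    rw [generated_cons, generated_map _ _ lowerHom ReducedTreePair.toHomeo_lower,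
      ReducedTreePair.toHomeo_upper,
      show juxt 1 b.2.toHomeo = upperHom b.2.toHomeo from rfl, ← MonoidHom.map_zpowers]
    exact ⟨(supMapEquivProd _ _).trans (e.prodCongr e')⟩
  · obtain ⟨⟨-, ht⟩, hp⟩ := hb
    have hp : b.2.size = n := hp
    refine cons_mem_maxSphere ((ReducedTreePair.size_upper _ (by omega)).trans (by omega)) ?_
    intro _ hq'
    obtain ⟨q, hq, rfl⟩ := Sym.mem_map.1 hq'
    exact q.size_lower_le.trans (Nat.succ_le_succ (ht.1 q hq))
  · rintro n hn ⟨t, p⟩ hb ⟨t', p'⟩ - he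
    have hp : p.size = n := hb.2
    obtain ⟨h1, h2⟩ := sym_cons_inj he fun hm => by
      obtain ⟨q, -, hq⟩ := Sym.mem_map.1 hm
      exact ReducedTreePair.upper_ne_lower (hn.trans hp.ge) q hq.symm
    exact Prod.ext (Sym.map_injective ReducedTreePair.lower_injective k h2)
      (ReducedTreePair.upper_injective h1)


/-! ### Restricted wreath products from displaced supports -/

theorem perm_inv_apply_self {X : Type*} (f : Equiv.Perm X) (x : X) : f⁻¹ (f x) = x :=
  f.symm_apply_apply x

section Scatter

variable {X H Q : Type*} [Group H] [Group Q]

open Classical in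
/-- The map which acts as the conjugate of `ι (f q)` by `θ q` on the translate `θ q '' U`, for
all `q`, and trivially elsewhere. -/
noncomputable def scatterFun (U : Set X) (θ : Q →* Equiv.Perm X) (ι : H →* Equiv.Perm X)
    (f : Q → H) (x : X) : X :=
  if h : ∃ q, ∃ u ∈ U, θ q u = x then θ h.choose (ι (f h.choose) h.choose_spec.choose) else x

/-- Conditions under which copies of `H` supported in the translates of `U` commute. -/
structure Displaced (U : Set X) (θ : Q →* Equiv.Perm X) (ι : H →* Equiv.Perm X) : Prop where
  nonempty : U.Nonempty
  displaced : ∀ q, q ≠ 1 → ∀ x ∈ U, θ q x ∉ U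
  support : ∀ h, ∀ x ∉ U, ι h x = x
  injective : Function.Injective ι

namespace Displaced

variable {U : Set X} {θ : Q →* Equiv.Perm X} {ι : H →* Equiv.Perm X}

theorem apply_mem (hd : Displaced U θ ι) (h : H) {u : X} (hu : u ∈ U) : ι h u ∈ U := by
  by_contra hn
  have h1 := hd.support h⁻¹ _ hn
  rw [map_inv, perm_inv_apply_self] at h1
  exact hn (h1 ▸ hu)

/-- Displacement makes the translates of `U` pairwise disjoint and the action on them free, so the
choice in `scatterFun` is immaterial. -/
theorem unique (hd : Displaced U θ ι) {q q' : Q} {u u' : X} (hu : u ∈ U) (hu' : u' ∈ U)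
    (h : θ q u = θ q' u') : q = q' ∧ u = u' := by
  have h1 : θ (q'⁻¹ * q) u = u' := by
    rw [map_mul, Equiv.Perm.mul_apply, h, map_inv, perm_inv_apply_self]
  have h2 : q'⁻¹ * q = 1 := by
    by_contra hne
    exact hd.displaced _ hne u hu (h1 ▸ hu')
  rw [h2, map_one] at h1
  exact ⟨(inv_mul_eq_one.1 h2).symm, h1⟩

theorem scatterFun_translate (hd : Displaced U θ ι) (f : Q → H) (q : Q) {u : X} (hu : u ∈ U) :
    scatterFun U θ ι f (θ q u) = θ q (ι (f q) u) := by
  have h : ∃ q', ∃ u' ∈ U, θ q' u' = θ q u := ⟨q, u, hu, rfl⟩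
  have key : ∀ q' u', u' ∈ U → θ q' u' = θ q u → θ q' (ι (f q') u') = θ q (ι (f q) u) := by
    intro q' u' hu' he
    obtain ⟨rfl, rfl⟩ := hd.unique hu' hu he
    rfl
  rw [scatterFun, dif_pos h]
  exact key _ _ h.choose_spec.choose_spec.1 h.choose_spec.choose_spec.2

theorem scatterFun_of_not (f : Q → H) {x : X} (hx : ¬ ∃ q, ∃ u ∈ U, θ q u = x) :
    scatterFun U θ ι f x = x := dif_neg hx

theorem scatterFun_mul (hd : Displaced U θ ι) (f f' : Q → H) (x : X) :
    scatterFun U θ ι (f * f') x = scatterFun U θ ι f (scatterFun U θ ι f' x) := by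
  by_cases hx : ∃ q, ∃ u ∈ U, θ q u = x
  · obtain ⟨q, u, hu, rfl⟩ := hx
    rw [hd.scatterFun_translate _ _ hu, hd.scatterFun_translate _ _ hu,
      hd.scatterFun_translate _ _ (hd.apply_mem _ hu), Pi.mul_apply, map_mul]
    rfl
  · rw [scatterFun_of_not _ hx, scatterFun_of_not _ hx, scatterFun_of_not _ hx]

theorem scatterFun_one (hd : Displaced U θ ι) (x : X) :
    scatterFun U θ ι (1 : Q → H) x = x := by
  by_cases hx : ∃ q, ∃ u ∈ U, θ q u = x
  · obtain ⟨q, u, hu, rfl⟩ := hx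
    rw [hd.scatterFun_translate _ _ hu, Pi.one_apply, map_one]
    rfl
  · exact scatterFun_of_not _ hx

/-- The action of the base group of the unrestricted wreath product. -/
noncomputable def scatter (hd : Displaced U θ ι) : (Q → H) →* Equiv.Perm X where
  toFun f := ⟨scatterFun U θ ι f, scatterFun U θ ι f⁻¹,
    fun x => by rw [← hd.scatterFun_mul, inv_mul_cancel, hd.scatterFun_one],
    fun x => by rw [← hd.scatterFun_mul, mul_inv_cancel, hd.scatterFun_one]⟩
  map_one' := Equiv.ext hd.scatterFun_one
  map_mul' f f' := Equiv.ext (hd.scatterFun_mul f f')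

theorem scatter_translate (hd : Displaced U θ ι) (f : Q → H) (q : Q) {u : X} (hu : u ∈ U) :
    hd.scatter f (θ q u) = θ q (ι (f q) u) := hd.scatterFun_translate f q hu

theorem scatter_of_not (hd : Displaced U θ ι) (f : Q → H) {x : X}
    (hx : ¬ ∃ q, ∃ u ∈ U, θ q u = x) : hd.scatter f x = x := scatterFun_of_not f hx

theorem mul_scatter (hd : Displaced U θ ι) (q : Q) (f : Q → H) :
    θ q * hd.scatter f = hd.scatter (fun x => f (q⁻¹ * x)) * θ q := by
  ext x
  rw [Equiv.Perm.mul_apply, Equiv.Perm.mul_apply]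
  by_cases hx : ∃ r, ∃ u ∈ U, θ r u = x
  · obtain ⟨r, u, hu, rfl⟩ := hx
    have h1 : ∀ y, θ q (θ r y) = θ (q * r) y := fun y => by rw [map_mul]; rfl
    rw [hd.scatter_translate _ _ hu, h1, h1, hd.scatter_translate _ _ hu, inv_mul_cancel_left]
  · rw [hd.scatter_of_not _ hx, hd.scatter_of_not]
    rintro ⟨r, u, hu, h⟩
    refine hx ⟨q⁻¹ * r, u, hu, ?_⟩
    rw [map_mul, Equiv.Perm.mul_apply, h, map_inv, perm_inv_apply_self]

/-- The action of the unrestricted wreath product. -/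
noncomputable def wreathHom (hd : Displaced U θ ι) : RegularWreathProduct H Q →* Equiv.Perm X where
  toFun w := hd.scatter w.left * θ w.right
  map_one' := by simp
  map_mul' a b := by
    rw [RegularWreathProduct.mul_left, RegularWreathProduct.mul_right, map_mul, map_mul, mul_assoc,
      mul_assoc, ← mul_assoc (θ a.right), hd.mul_scatter, mul_assoc]

/-- A trivially acting element keeps a point of `U` in place while moving it into the translate by
`w.right`, so `w.right = 1`. The component `w.left q` is then read off on the translate by `q`,
where `ι` is faithful. -/
theorem wreathHom_injective (hd : Displaced U θ ι) : Function.Injective hd.wreathHom := by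
  rw [injective_iff_map_eq_one]
  intro w hw
  have hw' : ∀ x, hd.scatter w.left (θ w.right x) = x := fun x => by
    change (hd.wreathHom w) x = x
    rw [hw]
    rfl
  have hr : w.right = 1 := by
    obtain ⟨u, hu⟩ := hd.nonempty
    have h := hw' u
    rw [hd.scatter_translate _ _ hu] at h
    refine (hd.unique (q' := 1) (hd.apply_mem (w.left w.right) hu) hu ?_).1
    rw [h, map_one]
    rfl
  ext1
  · funext q
    refine hd.injective ?_
    rw [RegularWreathProduct.one_left, Pi.one_apply, map_one]
    ext u
    by_cases hu : u ∈ U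
    · have h := hw' (θ q u)
      rw [hr, map_one, Equiv.Perm.one_apply, hd.scatter_translate _ _ hu] at h
      exact (θ q).injective h
    · exact hd.support _ _ hu
  · exact hr

theorem scatter_mulSingle [DecidableEq Q] (hd : Displaced U θ ι) (q : Q) (h : H) :
    hd.scatter (Pi.mulSingle q h) = θ q * ι h * (θ q)⁻¹ := by
  rw [eq_mul_inv_iff_mul_eq]
  ext x
  rw [Equiv.Perm.mul_apply, Equiv.Perm.mul_apply]
  by_cases hx : x ∈ U
  · rw [hd.scatter_translate _ _ hx, Pi.mulSingle_eq_same]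
  · rw [hd.support _ _ hx]
    by_cases hx' : ∃ r, ∃ u ∈ U, θ r u = θ q x
    · obtain ⟨r, u, hu, he⟩ := hx'
      rw [← he, hd.scatter_translate _ _ hu, Pi.mulSingle_eq_of_ne, map_one]
      · rfl
      · rintro rfl
        exact hx ((θ r).injective he ▸ hu)
    · exact hd.scatter_of_not _ hx'

/-- A finitely supported function is a finite product of single-coordinate ones, each of which acts
as a conjugate of an element of `ι.range` by one of `θ.range`. Finiteness of the support is what
singles out the restricted wreath product. -/
theorem scatter_mem (hd : Displaced U θ ι) (s : Finset Q) : ∀ f : Q → H,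
    Function.mulSupport f ⊆ s → hd.scatter f ∈ θ.range ⊔ ι.range := by
  classical
  induction s using Finset.induction_on with
  | empty =>
    intro f hf
    have : f = 1 := by
      rw [← Function.mulSupport_eq_empty_iff]
      exact Set.subset_empty_iff.1 (by simpa using hf)
    rw [this, map_one]
    exact one_mem _
  | insert a s ha ih =>
    intro f hf
    have h1 : f = Pi.mulSingle a (f a) * Function.update f a 1 := by
      funext q
      by_cases hq : q = a
      · subst hq; simp
      · simp [hq]
    rw [h1, map_mul, hd.scatter_mulSingle]
    have hθ : θ a ∈ θ.range ⊔ ι.range := Subgroup.mem_sup_left ⟨a, rfl⟩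
    have hι : ι (f a) ∈ θ.range ⊔ ι.range := Subgroup.mem_sup_right ⟨f a, rfl⟩
    refine mul_mem (mul_mem (mul_mem hθ hι) (inv_mem hθ)) (ih _ ?_)
    intro q hq
    have hqa : q ≠ a := by
      rintro rfl
      simp at hq
    have : q ∈ Function.mulSupport f := by
      simpa [hqa] using hq
    simpa [hqa] using hf this

end Displaced

end Scatter

theorem Displaced.nonempty_equiv {X H : Type*} [Group H] {U : Set X}
    {θ : Multiplicative ℤ →* Equiv.Perm X} {ι : H →* Equiv.Perm X} (hd : Displaced U θ ι) :
    Nonempty ((θ.range ⊔ ι.range : Subgroup (Equiv.Perm X)) ≃* WreathZ H) := by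
  classical
  have hinj : Function.Injective (hd.wreathHom.comp (restrictedWreath H).subtype) :=
    hd.wreathHom_injective.comp Subtype.val_injective
  refine ⟨((MonoidHom.ofInjective hinj).trans (MulEquiv.subgroupCongr ?_)).symm⟩
  refine le_antisymm ?_ (sup_le ?_ ?_)
  · rintro _ ⟨w, rfl⟩
    have hw : (Function.mulSupport w.1.left).Finite := w.2
    refine mul_mem (hd.scatter_mem hw.toFinset _ (by simp)) (Subgroup.mem_sup_left ⟨_, rfl⟩)
  · rintro _ ⟨q, rfl⟩
    refine ⟨⟨⟨1, q⟩, by simp [restrictedWreath]⟩, ?_⟩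
    change hd.scatter 1 * θ q = θ q
    rw [map_one, one_mul]
  · rintro _ ⟨h, rfl⟩
    refine ⟨⟨⟨Pi.mulSingle 1 h, 1⟩, ?_⟩, ?_⟩
    · exact (Set.finite_singleton 1).subset Pi.mulSupport_mulSingle_subset
    · change hd.scatter (Pi.mulSingle 1 h) * θ 1 = ι h
      rw [hd.scatter_mulSingle, map_one, inv_one, mul_one, mul_one, one_mul]

/-- The underlying permutation of an order automorphism of the interval. -/
def permHom : (unitInterval ≃o unitInterval) →* Equiv.Perm unitInterval where
  toFun f := f.toEquiv
  map_one' := rfl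
  map_mul' _ _ := rfl

theorem permHom_injective : Function.Injective permHom := fun _ _ h =>
  RelIso.ext fun x => congrArg (fun e : Equiv.Perm unitInterval => e x) h

theorem le_pow_succ_apply {g : unitInterval ≃o unitInterval} {a b : unitInterval} (hab : a ≤ b)
    (h : g a = b) (n : ℕ) (x : unitInterval) (hx : a ≤ x) : b ≤ (g ^ (n + 1)) x := by
  rw [← h]
  exact (le_pow_apply_of_le (h.symm ▸ hab) n).trans ((g ^ (n + 1)).monotone hx)

theorem nonempty_zpowers_sup_map_equiv {H : Type*} [Group H]
    {K : Subgroup (unitInterval ≃o unitInterval)} (e : K ≃* H) {g : unitInterval ≃o unitInterval}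
    (hg : g (lowerHalf (upperHalf 0)) = upperHalf 0) :
    Nonempty ((Subgroup.zpowers g ⊔ K.map (lowerHom.comp upperHom) :
      Subgroup (unitInterval ≃o unitInterval)) ≃* WreathZ H) := by
  set a := lowerHalf (upperHalf 0) with ha
  set b := upperHalf 0 with hb
  have hab : a < b := by
    rw [← Subtype.coe_lt_coe, ha, hb, coe_lowerHalf, coe_upperHalf]
    norm_num
  set ι : H →* Equiv.Perm unitInterval :=
    permHom.comp ((lowerHom.comp upperHom).comp (K.subtype.comp e.symm.toMonoidHom)) with hι
  set θ : Multiplicative ℤ →* Equiv.Perm unitInterval :=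
    permHom.comp (zpowersHom _ g) with hθ
  -- Since `g a = b`, every positive power of `g` pushes the interval to the right of `b`; negative
  -- powers follow by exchanging the roles of a point and its image.
  have hpos : ∀ n : ℕ, ∀ x ∈ Set.Ico a b, (g ^ (n + 1)) x ∉ Set.Ico a b := fun n x hx h =>
    absurd (le_pow_succ_apply hab.le hg n x hx.1) (not_le.2 h.2)
  have hd : Displaced (Set.Ico a b) θ ι := by
    refine ⟨⟨a, le_rfl, hab⟩, fun q hq x hx hx' => ?_, fun h x hx => ?_, ?_⟩
    · have hq' : q.toAdd ≠ 0 := hq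
      have hx'' : (g ^ q.toAdd) x ∈ Set.Ico a b := hx'
      obtain ⟨n, hn | hn⟩ := q.toAdd.eq_nat_or_neg
      · rw [hn, zpow_natCast] at hx''
        obtain ⟨n, rfl⟩ := Nat.exists_eq_add_of_le' (show 1 ≤ n by omega)
        exact hpos n x hx hx''
      · rw [hn, zpow_neg, zpow_natCast] at hx''
        obtain ⟨n, rfl⟩ := Nat.exists_eq_add_of_le' (show 1 ≤ n by omega)
        refine hpos n _ hx'' ?_
        rwa [RelIso.apply_inv_self]
    · have h1 : ι h x = juxt (juxt 1 (e.symm h : unitInterval ≃o unitInterval)) 1 x := rfl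
      rw [h1]
      rcases eq_half_cases x with ⟨y, rfl⟩ | ⟨y, rfl⟩
      · rw [juxt_lowerHalf]
        rcases eq_half_cases y with ⟨z, rfl⟩ | ⟨z, rfl⟩
        · rw [juxt_lowerHalf]
          rfl
        · have h2 : b ≤ lowerHalf (upperHalf z) := by
            by_contra hlt
            exact hx ⟨lowerHalf_le_iff.2 (upperHalf_le_iff.2 z.2.1), not_le.1 hlt⟩
          rw [hb, ← lowerHalf_one, lowerHalf_le_iff,
            show (1 : unitInterval) = upperHalf 1 from Subtype.ext (by simp [coe_upperHalf]),
            upperHalf_le_iff] at h2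
          obtain rfl : z = 1 := le_antisymm z.2.2 h2
          rw [juxt_upperHalf, orderIso_one]
      · rw [juxt_upperHalf]
        rfl
    · intro x y hxy
      have h1 := permHom_injective hxy
      have h2 := juxtHom_injective h1
      have h3 := juxtHom_injective (Prod.mk.inj h2).1
      exact e.symm.injective (Subtype.ext (Prod.mk.inj h3).2)
  obtain ⟨e'⟩ := hd.nonempty_equiv
  have hr : (Subgroup.zpowers g ⊔ K.map (lowerHom.comp upperHom)).map permHom =
      θ.range ⊔ ι.range := by
    rw [Subgroup.map_sup, hι, hθ, ← MonoidHom.map_range, ← MonoidHom.map_range,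
      ← MonoidHom.map_range, ← MonoidHom.map_range]
    congr 2
    · rw [MonoidHom.range_eq_top.2 e.symm.surjective, ← MonoidHom.range_eq_map, K.range_subtype]
  exact ⟨((Subgroup.equivMapOfInjective _ permHom permHom_injective).trans
    (MulEquiv.subgroupCongr hr)).trans e'⟩

/-- Squeezing into `[1/4,1/2]` costs at most two carets, and `rotation` adds exactly two, so the new
entry fixes the radius `n + 2`. -/
theorem InMaxSpec.wreath_int {k : ℕ} {H : Type*} [Group H] (hk : 1 ≤ k) (h : InMaxSpec k H) :
    InMaxSpec (k + 1) (WreathZ H) := by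
  refine (h.isLarge hk).prod.inMaxSpec 2 (fun b => b.2.rotation ::ₛ
    b.1.map (ReducedTreePair.lower ∘ ReducedTreePair.upper)) (fun n hn b hb => ⟨?_, ?_⟩) ?_
  · obtain ⟨⟨ht, -⟩, -⟩ := hb
    rw [mem_generatingTuples] at ht ⊢
    obtain ⟨e⟩ := ht
    rw [generated_cons, generated_map _ _ (lowerHom.comp upperHom) fun p => by
      rw [Function.comp_apply, ReducedTreePair.toHomeo_lower, ReducedTreePair.toHomeo_upper]; rfl]
    exact nonempty_zpowers_sup_map_equiv e b.2.toHomeo_rotation_quarter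
  · obtain ⟨⟨-, ht⟩, hp⟩ := hb
    have hp : b.2.size = n := hp
    refine cons_mem_maxSphere ((ReducedTreePair.size_rotation _ (by omega)).trans (by omega)) ?_
    intro _ hq'
    obtain ⟨q, hq, rfl⟩ := Sym.mem_map.1 hq'
    exact q.upper.size_lower_le.trans
      (Nat.succ_le_succ (q.size_upper_le.trans (Nat.succ_le_succ (ht.1 q hq))))
  · rintro n hn ⟨t, p⟩ hb ⟨t', p'⟩ - he
    obtain ⟨h1, h2⟩ := sym_cons_inj he fun hm => by
      obtain ⟨q, -, hq⟩ := Sym.mem_map.1 hm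
      exact ReducedTreePair.rotation_ne_lower p q.upper hq.symm
    exact Prod.ext (Sym.map_injective (ReducedTreePair.lower_injective.comp
      ReducedTreePair.upper_injective) k h2) (ReducedTreePair.rotation_injective h1)


/-! ### Thompson's group is generated by two elements -/

theorem leafPoint_node_leafCoord_left (l r : BinaryTree Unit) (x : unitInterval) :
    leafPoint (.node () l r) (leafCoord l x) = x / 2 := by
  rw [leafPoint, if_pos (leafCoord_mem l x x.2.1 x.2.2).2, leafPoint_leafCoord l x x.2.1 x.2.2]

theorem leafPoint_node_leafCoord_right (l r : BinaryTree Unit) (x : unitInterval) :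
    leafPoint (.node () l r) (l.numLeaves + leafCoord r x) = (1 + x) / 2 := by
  rw [leafPoint_node_add _ _ _ (leafCoord_mem r x x.2.1 x.2.2).1,
    leafPoint_leafCoord r x x.2.1 x.2.2]

section Rotation

variable (a b c : BinaryTree Unit)
  (h : (BinaryTree.node () (.node () a b) c).numNodes =
    (BinaryTree.node () a (.node () b c)).numNodes)

theorem treePairMap_rotation_lower_lower (x : unitInterval) :
    treePairMap _ _ h (lowerHalf (lowerHalf x)) = lowerHalf x := by
  ext
  rw [treePairMap_apply, leafCoord_node_lowerHalf, leafCoord_node_lowerHalf,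
    leafPoint_node_leafCoord_left, coe_lowerHalf]

theorem treePairMap_rotation_lower_upper (x : unitInterval) :
    treePairMap _ _ h (lowerHalf (upperHalf x)) = upperHalf (lowerHalf x) := by
  ext
  rw [treePairMap_apply, leafCoord_node_lowerHalf, leafCoord_node_upperHalf,
    leafPoint_node_add _ _ _ (leafCoord_mem b x x.2.1 x.2.2).1, leafPoint_node_leafCoord_left,
    coe_upperHalf, coe_lowerHalf]

theorem treePairMap_rotation_upper (x : unitInterval) :
    treePairMap _ _ h (upperHalf x) = upperHalf (upperHalf x) := by
  ext
  rw [treePairMap_apply, leafCoord_node_upperHalf, numLeaves_cast_node, add_assoc,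
    leafPoint_node_add _ _ _ (add_nonneg (Nat.cast_nonneg _) (leafCoord_mem c x x.2.1 x.2.2).1),
    leafPoint_node_leafCoord_right, coe_upperHalf, coe_upperHalf]

end Rotation

/-- The pair of the rotation of a tree with two carets. -/
def pairX : ReducedTreePair := ReducedTreePair.idPair.rotation

theorem pairX_lower_lower (x : unitInterval) :
    pairX.toHomeo (lowerHalf (lowerHalf x)) = lowerHalf x :=
  treePairMap_rotation_lower_lower .nil .nil .nil rfl x

theorem pairX_lower_upper (x : unitInterval) :
    pairX.toHomeo (lowerHalf (upperHalf x)) = upperHalf (lowerHalf x) :=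
  treePairMap_rotation_lower_upper .nil .nil .nil rfl x

theorem pairX_upper (x : unitInterval) :
    pairX.toHomeo (upperHalf x) = upperHalf (upperHalf x) :=
  treePairMap_rotation_upper .nil .nil .nil rfl x

/-- A rotation at the root gives the same homeomorphism whatever trees are grafted, since these are
the same in source and target. -/
theorem treePairMap_rotation (a b c : BinaryTree Unit)
    (h : (BinaryTree.node () (.node () a b) c).numNodes =
      (BinaryTree.node () a (.node () b c)).numNodes) :
    treePairMap _ _ h = pairX.toHomeo := by
  refine RelIso.ext fun x => ?_
  rcases eq_half_cases x with ⟨x, rfl⟩ | ⟨x, rfl⟩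
  · rcases eq_half_cases x with ⟨x, rfl⟩ | ⟨x, rfl⟩
    · rw [treePairMap_rotation_lower_lower, pairX_lower_lower]
    · rw [treePairMap_rotation_lower_upper, pairX_lower_upper]
  · rw [treePairMap_rotation_upper, pairX_upper]

/-- Conjugation by the first generator moves a copy on `[1/2,1]` to `[3/4,1]`. Hence the group
generated by two elements absorbs all further standard generators. -/
theorem pairX_mul_juxt (f : unitInterval ≃o unitInterval) :
    pairX.toHomeo * juxt 1 f = juxt 1 (juxt 1 f) * pairX.toHomeo := by
  refine RelIso.ext fun x => ?_
  rw [RelIso.mul_apply, RelIso.mul_apply]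
  rcases eq_half_cases x with ⟨x, rfl⟩ | ⟨x, rfl⟩
  · rw [juxt_lowerHalf, RelIso.one_apply]
    rcases eq_half_cases x with ⟨x, rfl⟩ | ⟨x, rfl⟩
    · rw [pairX_lower_lower, juxt_lowerHalf, RelIso.one_apply]
    · rw [pairX_lower_upper, juxt_upperHalf, juxt_lowerHalf, RelIso.one_apply]
  · rw [juxt_upperHalf, pairX_upper, pairX_upper, juxt_upperHalf, juxt_upperHalf]

/-- The subgroup generated by the two standard generators of Thompson's group. -/
noncomputable def genX : Subgroup (unitInterval ≃o unitInterval) :=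
  Subgroup.closure {pairX.toHomeo, juxt 1 pairX.toHomeo}

theorem pairX_mem_genX : pairX.toHomeo ∈ genX := Subgroup.subset_closure (Or.inl rfl)

theorem juxt_pairX_mem_genX : juxt 1 pairX.toHomeo ∈ genX := Subgroup.subset_closure (Or.inr rfl)

theorem juxt_mem_genX {f : unitInterval ≃o unitInterval} (hf : f ∈ genX) :
    juxt 1 f ∈ genX := by
  have h : genX ≤ genX.comap upperHom := by
    rw [genX, Subgroup.closure_le]
    rintro _ (rfl | rfl)
    · exact juxt_pairX_mem_genX
    · change juxt 1 (juxt 1 pairX.toHomeo) ∈ genX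
      rw [eq_mul_inv_of_mul_eq (pairX_mul_juxt pairX.toHomeo).symm]
      exact mul_mem (mul_mem pairX_mem_genX juxt_pairX_mem_genX) (inv_mem pairX_mem_genX)
  exact h hf

/-- The tree with `n` carets all of which lie on the right spine. -/
def rightComb : ℕ → BinaryTree Unit
  | 0 => .nil
  | n + 1 => .node () .nil (rightComb n)

theorem numNodes_rightComb (n : ℕ) : (rightComb n).numNodes = n := by
  induction n with
  | zero => rfl
  | succ n ih => simp [rightComb, ih]

/-- Rotating at the root shortens the left subtree until it is empty, at the cost of the first
generator; the right subtree is then treated recursively inside `[1/2,1]`. -/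
theorem treePairMap_rightComb_mem : ∀ (S : BinaryTree Unit) (n : ℕ)
    (h : S.numNodes = (rightComb n).numNodes), treePairMap S (rightComb n) h ∈ genX
  | .nil, n, h => by
    rw [numNodes_rightComb] at h
    subst h
    have key : treePairMap .nil .nil rfl ∈ genX := by
      rw [treePairMap_self]
      exact one_mem _
    exact key
  | .node () .nil r, n, h => by
    have hn : r.numNodes + 1 = n := by
      rw [numNodes_rightComb] at h
      simpa using h
    subst hn
    have hr : r.numNodes = (rightComb r.numNodes).numNodes := (numNodes_rightComb _).symm
    have key : treePairMap (.node () .nil r) (.node () .nil (rightComb r.numNodes)) h ∈ genX := by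
      have h' := treePairMap_node (l := .nil) (l' := .nil) rfl hr h
      rw [treePairMap_self] at h'
      exact h' ▸ juxt_mem_genX (treePairMap_rightComb_mem r _ hr)
    exact key
  | .node () (.node () a b) c, n, h => by
    have h1 : (BinaryTree.node () (.node () a b) c).numNodes =
        (BinaryTree.node () a (.node () b c)).numNodes := by
      simp only [BinaryTree.numNodes]
      omega
    rw [← treePairMap_mul _ _ _ h1 (h1.symm.trans h), treePairMap_rotation]
    exact mul_mem (treePairMap_rightComb_mem (.node () a (.node () b c)) n _) pairX_mem_genX
termination_by S => (S.numNodes, S.left.numNodes)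
decreasing_by
  all_goals
    simp only [BinaryTree.numNodes, BinaryTree.left, Prod.lex_def]
    omega

theorem treePairMap_mem_genX (S T : BinaryTree Unit) (h : S.numNodes = T.numNodes) :
    treePairMap S T h ∈ genX := by
  have hT : T.numNodes = (rightComb T.numNodes).numNodes := (numNodes_rightComb _).symm
  have h1 : treePairMap S T h = (treePairMap T _ hT)⁻¹ * treePairMap S _ (h.trans hT) := by
    rw [treePairMap_inv, treePairMap_mul]
  rw [h1]
  exact mul_mem (inv_mem (treePairMap_rightComb_mem _ _ _)) (treePairMap_rightComb_mem _ _ _)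

/-! ### Every element of `F` comes from a tree pair -/

/-- The complete binary tree of a given height. -/
def completeTree : ℕ → BinaryTree Unit
  | 0 => .nil
  | n + 1 => .node () (completeTree n) (completeTree n)

theorem leafCoord_completeTree (n : ℕ) (x : unitInterval) :
    leafCoord (completeTree n) x = 2 ^ n * x := by
  induction n generalizing x with
  | zero => simp [completeTree, leafCoord]
  | succ n ih =>
    rcases eq_half_cases x with ⟨x, rfl⟩ | ⟨x, rfl⟩
    · rw [completeTree, leafCoord_node_lowerHalf, ih, coe_lowerHalf]
      ring
    · rw [completeTree, leafCoord_node_upperHalf, ih, coe_upperHalf, ← leafCoord_one,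
        show (1 : ℝ) = ((1 : unitInterval) : ℝ) from rfl, ih]
      rw [show ((1 : unitInterval) : ℝ) = 1 from rfl]
      ring

/-- A function which is affine on all dyadic intervals of length `2⁻ᴺ`, mapping each of them onto an
interval whose length is a positive integral power of two, is a leaf coordinate up to a constant. -/
theorem exists_leafCoord_eq (N : ℕ) : ∀ φ : unitInterval → ℝ,
    (∀ i : ℕ, i < 2 ^ N → ∃ (L : ℕ) (C : ℝ), ∀ x : unitInterval, (i : ℝ) ≤ 2 ^ N * x →
      2 ^ N * (x : ℝ) ≤ i + 1 → φ x = C + 2 ^ L * (2 ^ N * x)) →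
    ∃ S : BinaryTree Unit, ∀ x : unitInterval, leafCoord S x = φ x - φ 0 := by
  induction N with
  | zero =>
    intro φ h
    obtain ⟨L, C, h⟩ := h 0 (by simp)
    refine ⟨completeTree L, fun x => ?_⟩
    rw [leafCoord_completeTree, h x (by simpa using x.2.1) (by simpa using x.2.2),
      h 0 (by simp) (by simp)]
    simp
  | succ N ih =>
    intro φ h
    obtain ⟨l, hl⟩ := ih (fun x => φ (lowerHalf x)) fun i hi => by
      obtain ⟨L, C, h⟩ := h i (hi.trans_le (Nat.pow_le_pow_right two_pos N.le_succ))
      refine ⟨L, C, fun x h1 h2 => ?_⟩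
      have e : (2 : ℝ) ^ (N + 1) * (lowerHalf x : ℝ) = 2 ^ N * x := by rw [coe_lowerHalf]; ring
      have := h (lowerHalf x)
      rw [e] at this
      exact this h1 h2
    obtain ⟨r, hr⟩ := ih (fun x => φ (upperHalf x)) fun i hi => by
      obtain ⟨L, C, h⟩ := h (2 ^ N + i) (by rw [pow_succ]; omega)
      refine ⟨L, C + 2 ^ L * 2 ^ N, fun x h1 h2 => ?_⟩
      have e : (2 : ℝ) ^ (N + 1) * (upperHalf x : ℝ) = 2 ^ N + 2 ^ N * x := by
        rw [coe_upperHalf]; ring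
      have := h (upperHalf x)
      rw [e] at this
      push_cast at this
      rw [this (by linarith) (by linarith)]
      ring
    have h0 : lowerHalf 0 = 0 := Subtype.ext (by simp [coe_lowerHalf])
    refine ⟨.node () l r, fun x => ?_⟩
    rcases eq_half_cases x with ⟨x, rfl⟩ | ⟨x, rfl⟩
    · rw [leafCoord_node_lowerHalf, hl, h0]
    · rw [leafCoord_node_upperHalf, hr, ← leafCoord_one,
        show (1 : ℝ) = ((1 : unitInterval) : ℝ) from rfl, hl, h0, lowerHalf_one]
      ring

theorem exists_common_denominator (B : Finset ℝ) (hB : ∀ c ∈ B, IsDyadic c) :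
    ∃ N : ℕ, ∀ c ∈ B, ∃ m : ℤ, 2 ^ N * c = m := by
  classical
  induction B using Finset.induction_on with
  | empty => exact ⟨0, by simp⟩
  | insert a s _ ih =>
    obtain ⟨N, hN⟩ := ih fun c hc => hB c (Finset.mem_insert_of_mem hc)
    obtain ⟨m, n, hm⟩ := hB a (Finset.mem_insert_self _ _)
    refine ⟨N + n, fun c hc => ?_⟩
    rcases Finset.mem_insert.1 hc with rfl | hc
    · exact ⟨2 ^ N * m, by rw [hm, pow_add]; push_cast; field_simp⟩
    · obtain ⟨m', hm'⟩ := hN c hc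
      exact ⟨2 ^ n * m', by push_cast; rw [← hm', pow_add]; ring⟩

/-- The target is a complete tree of large height `M`. Its leaf coordinate composed with `f` is `2 ^
M * f`, which `exists_leafCoord_eq` recognises as the leaf coordinate of a source tree. -/
theorem exists_eq_treePairMap {f : unitInterval ≃o unitInterval} (hf : f ∈ F) :
    ∃ S T h, f = treePairMap S T h := by
  obtain ⟨B, hB, hf⟩ := hf
  obtain ⟨N, hN⟩ := exists_common_denominator B hB
  have hp : (0 : ℝ) < 2 ^ N := by positivity
  have hk : ∀ i : ℕ, i < 2 ^ N → ∃ (k : ℤ) (C : ℝ), ∀ x : unitInterval, (i : ℝ) ≤ 2 ^ N * x →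
      2 ^ N * (x : ℝ) ≤ i + 1 → (f x : ℝ) = C + 2 ^ k * x := by
    intro i hi
    have hi' : (i : ℝ) + 1 ≤ 2 ^ N := by exact_mod_cast hi
    let a : unitInterval := ⟨i / 2 ^ N, by positivity, by rw [div_le_one hp]; linarith⟩
    let b : unitInterval := ⟨(i + 1) / 2 ^ N, by positivity, by rw [div_le_one hp]; exact hi'⟩
    have hab : a < b := by
      rw [← Subtype.coe_lt_coe]
      exact div_lt_div_of_pos_right (by linarith) hp
    obtain ⟨k, hk⟩ := hf a b hab fun c hc h => by
      obtain ⟨m, hm⟩ := hN c hc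
      have h1 : (i : ℝ) / 2 ^ N < c := h.1
      have h2 : c < ((i : ℝ) + 1) / 2 ^ N := h.2
      rw [div_lt_iff₀ hp, mul_comm, hm] at h1
      rw [lt_div_iff₀ hp, mul_comm, hm] at h2
      have h3 : (i : ℤ) < m := by exact_mod_cast h1
      have h4 : m < (i : ℤ) + 1 := by exact_mod_cast h2
      omega
    refine ⟨k, f a - 2 ^ k * a, fun x h1 h2 => ?_⟩
    rw [hk x]
    · ring
    · rw [← Subtype.coe_le_coe]
      change (i : ℝ) / 2 ^ N ≤ x
      rwa [div_le_iff₀ hp, mul_comm]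
    · rw [← Subtype.coe_le_coe]
      change (x : ℝ) ≤ (i + 1) / 2 ^ N
      rwa [le_div_iff₀ hp, mul_comm]
  choose! k hk using hk
  -- With slope `2 ^ k i` on the `i`-th interval of length `2⁻ᴺ`, its image under `2 ^ M * f` has
  -- length `2 ^ (M + k i - N)`; the exponent must be nonnegative for all `i`.
  obtain ⟨M, hM⟩ : ∃ M : ℕ, ∀ i < 2 ^ N, (N : ℤ) - k i ≤ M := by
    obtain ⟨M, hM⟩ := ((Finset.range (2 ^ N)).image fun i => ((N : ℤ) - k i).toNat).bddAbove
    refine ⟨M, fun i hi => ?_⟩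
    have := hM (Finset.mem_coe.2 (Finset.mem_image_of_mem _ (Finset.mem_range.2 hi)))
    omega
  obtain ⟨S, hS⟩ := exists_leafCoord_eq N (fun x => 2 ^ M * f x) fun i hi => by
    obtain ⟨C, hC⟩ := hk i hi
    obtain ⟨L, hL⟩ := Int.eq_ofNat_of_zero_le (sub_nonneg.2 (hM i hi))
    refine ⟨L, 2 ^ M * C, fun x h1 h2 => ?_⟩
    have e : (2 : ℝ) ^ M * 2 ^ k i = 2 ^ L * 2 ^ N := by
      rw [← zpow_natCast, ← zpow_natCast, ← zpow_natCast, ← zpow_add₀ two_ne_zero,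
        ← zpow_add₀ two_ne_zero]
      congr 1
      omega
    rw [hC x h1 h2, mul_add, ← mul_assoc, ← mul_assoc, e]
  have hS' : ∀ x : unitInterval, leafCoord S x = leafCoord (completeTree M) (f x) := by
    intro x
    rw [hS, leafCoord_completeTree, orderIso_zero]
    simp
  have hn : S.numNodes = (completeTree M).numNodes := by
    have h1 := hS' 1
    rw [orderIso_one, show ((1 : unitInterval) : ℝ) = 1 from rfl, leafCoord_one,
      leafCoord_one] at h1
    have h2 : S.numLeaves = (completeTree M).numLeaves := by exact_mod_cast h1
    rw [BinaryTree.numLeaves_eq_numNodes_succ, BinaryTree.numLeaves_eq_numNodes_succ] at h2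
    omega
  refine ⟨S, completeTree M, hn, RelIso.ext fun x => Subtype.ext ?_⟩
  rw [treePairMap_apply, hS', leafPoint_leafCoord _ _ (f x).2.1 (f x).2.2]

theorem genX_eq : genX = F := by
  refine le_antisymm ((Subgroup.closure_le _).2 ?_) fun f hf => ?_
  · rintro _ (rfl | rfl)
    · exact pairX.toF.2
    · rw [← ReducedTreePair.toHomeo_upper]
      exact pairX.upper.toF.2
  · obtain ⟨S, T, h, rfl⟩ := exists_eq_treePairMap hf
    exact treePairMap_mem_genX S T h


/-! ### Slopes at the endpoints -/

/-- With respect to the distance `d` to an endpoint of the interval, `f` is multiplication by `2 ^ k`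
near this endpoint. -/
def HasGerm (d : unitInterval → ℝ) (f : unitInterval ≃o unitInterval) (k : ℤ) : Prop :=
  ∃ ε : ℝ, 0 < ε ∧ ∀ x, (d x ≤ ε ∨ d (f x) ≤ ε) → d (f x) = 2 ^ k * d x

/-- The distance to the left endpoint. -/
def distZero (x : unitInterval) : ℝ := x

/-- The distance to the right endpoint. -/
def distOne (x : unitInterval) : ℝ := 1 - x

theorem HasGerm.one (d : unitInterval → ℝ) : HasGerm d 1 0 :=
  ⟨1, one_pos, fun x _ => by simp⟩

/-- The condition in `HasGerm` admits `x` or `f x` close to the endpoint, so it is symmetric and the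
same `ε` serves for the inverse. -/
theorem HasGerm.inv {d : unitInterval → ℝ} {f : unitInterval ≃o unitInterval} {k : ℤ}
    (h : HasGerm d f k) : HasGerm d f⁻¹ (-k) := by
  obtain ⟨ε, hε, h⟩ := h
  refine ⟨ε, hε, fun y hy => ?_⟩
  obtain ⟨x, rfl⟩ := f.surjective y
  rw [RelIso.inv_apply_self] at *
  rw [h x hy.symm, zpow_neg]
  field_simp

theorem HasGerm.mul {d : unitInterval → ℝ} {f g : unitInterval ≃o unitInterval} {k l : ℤ}
    (hf : HasGerm d f k) (hg : HasGerm d g l) : HasGerm d (f * g) (k + l) := by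
  obtain ⟨ε, hε, hf⟩ := hf
  obtain ⟨δ, hδ, hg⟩ := hg
  have hk : (0 : ℝ) < 2 ^ k := by positivity
  have hl : (0 : ℝ) < 2 ^ l := by positivity
  -- If `x` is close, `δ` and `ε / 2 ^ l` make `g` and then `f` linear along the orbit; if the final
  -- image is close, `ε` and `δ * 2 ^ k` do so backwards.
  refine ⟨min (min ε δ) (min (ε / 2 ^ l) (δ * 2 ^ k)), by positivity, fun x hx => ?_⟩
  simp only [RelIso.mul_apply, le_min_iff] at *
  have key : d (g x) = 2 ^ l * d x ∧ d (f (g x)) = 2 ^ k * d (g x) := by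
    rcases hx with hx | hx
    · have h1 := hg x (Or.inl hx.1.2)
      refine ⟨h1, hf _ (Or.inl ?_)⟩
      have h2 := hx.2.1
      rw [le_div_iff₀ hl] at h2
      linarith
    · have h1 := hf (g x) (Or.inr hx.1.1)
      refine ⟨hg _ (Or.inr ?_), h1⟩
      have h2 := hx.2.2
      rw [h1, mul_comm δ] at h2
      exact le_of_mul_le_mul_left h2 hk
  rw [key.2, key.1, zpow_add₀ two_ne_zero]
  ring

theorem HasGerm.eq_zero {d : unitInterval → ℝ} (hd : ∀ ε : ℝ, 0 < ε → ∃ x, 0 < d x ∧ d x ≤ ε)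
    {k : ℤ} (h : HasGerm d 1 k) : k = 0 := by
  obtain ⟨ε, hε, h⟩ := h
  obtain ⟨x, hx, hx'⟩ := hd ε hε
  have h1 := h x (Or.inl hx')
  rw [RelIso.one_apply] at h1
  have h2 : (2 : ℝ) ^ k = 1 := by
    have := mul_right_cancel₀ hx.ne' (show 2 ^ k * d x = 1 * d x by linarith)
    exact this
  exact zpow_right_injective₀ (a := (2 : ℝ)) two_pos (by norm_num) (by simpa using h2)

theorem exists_distZero (ε : ℝ) (hε : 0 < ε) : ∃ x, 0 < distZero x ∧ distZero x ≤ ε :=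
  ⟨⟨min ε 1, by positivity, min_le_right _ _⟩, lt_min hε one_pos, min_le_left _ _⟩

theorem exists_distOne (ε : ℝ) (hε : 0 < ε) : ∃ x, 0 < distOne x ∧ distOne x ≤ ε :=
  ⟨⟨1 - min ε 1, by linarith [min_le_right ε 1], by linarith [lt_min hε one_pos]⟩, by
    simp [distOne, hε], by simp [distOne]⟩

theorem HasGerm.juxt_zero {f : unitInterval ≃o unitInterval} {k : ℤ} (h : HasGerm distZero f k)
    (g : unitInterval ≃o unitInterval) : HasGerm distZero (juxt f g) k := by
  obtain ⟨ε, hε, h⟩ := h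
  refine ⟨min (ε / 2) (1 / 4), by positivity, fun x hx => ?_⟩
  simp only [le_min_iff, distZero] at *
  rcases eq_half_cases x with ⟨x, rfl⟩ | ⟨x, rfl⟩
  · rw [juxt_lowerHalf, coe_lowerHalf, coe_lowerHalf] at *
    rw [h x (hx.imp (fun h => by linarith [h.1]) fun h => by linarith [h.1])]
    ring
  · rw [juxt_upperHalf, coe_upperHalf, coe_upperHalf] at *
    have h1 := x.2.1
    have h2 := (g x).2.1
    rcases hx with hx | hx <;> linarith [hx.2]

theorem HasGerm.juxt_one {g : unitInterval ≃o unitInterval} {k : ℤ} (h : HasGerm distOne g k)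
    (f : unitInterval ≃o unitInterval) : HasGerm distOne (juxt f g) k := by
  obtain ⟨ε, hε, h⟩ := h
  refine ⟨min (ε / 2) (1 / 4), by positivity, fun x hx => ?_⟩
  simp only [le_min_iff, distOne] at *
  rcases eq_half_cases x with ⟨x, rfl⟩ | ⟨x, rfl⟩
  · rw [juxt_lowerHalf, coe_lowerHalf, coe_lowerHalf] at *
    have h1 := x.2.2
    have h2 := (f x).2.2
    rcases hx with hx | hx <;> linarith [hx.2]
  · rw [juxt_upperHalf, coe_upperHalf, coe_upperHalf] at *
    have := h x (hx.imp (fun h => by linarith [h.1]) fun h => by linarith [h.1])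
    linear_combination this / 2

theorem pairX_germ_zero : HasGerm distZero pairX.toHomeo 1 := by
  refine ⟨1 / 8, by norm_num, fun x hx => ?_⟩
  simp only [distZero] at *
  rcases eq_half_cases x with ⟨x, rfl⟩ | ⟨x, rfl⟩
  · rcases eq_half_cases x with ⟨x, rfl⟩ | ⟨x, rfl⟩
    · rw [pairX_lower_lower, zpow_one]
      simp only [coe_lowerHalf]
      ring
    · rw [pairX_lower_upper, coe_upperHalf, coe_lowerHalf, coe_lowerHalf, coe_upperHalf] at *
      have := x.2.1
      rcases hx with hx | hx <;> linarith
  · rw [pairX_upper] at *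
    simp only [coe_upperHalf] at *
    have := x.2.1
    rcases hx with hx | hx <;> linarith

theorem pairX_germ_one : HasGerm distOne pairX.toHomeo (-1) := by
  refine ⟨1 / 8, by norm_num, fun x hx => ?_⟩
  simp only [distOne] at *
  rcases eq_half_cases x with ⟨x, rfl⟩ | ⟨x, rfl⟩
  · rcases eq_half_cases x with ⟨x, rfl⟩ | ⟨x, rfl⟩
    · rw [pairX_lower_lower, coe_lowerHalf, coe_lowerHalf] at *
      have := x.2.2
      rcases hx with hx | hx <;> linarith
    · rw [pairX_lower_upper, coe_upperHalf, coe_lowerHalf, coe_lowerHalf, coe_upperHalf] at *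
      have := x.2.2
      rcases hx with hx | hx <;> linarith
  · rw [pairX_upper, coe_upperHalf, coe_upperHalf, zpow_neg_one]
    ring

/-! ### Tuples generating Thompson's group -/

/-- The first coordinates generate `F`; the second is a function of the endpoint slopes of the
first, so projection to the first coordinate is injective for arbitrary `a` and `b`. -/
theorem nonempty_closure_equiv_F (a b : unitInterval ≃o unitInterval)
    (W : Set (unitInterval ≃o unitInterval))
    (hW : ∀ w ∈ W, w ∈ F ∧ HasGerm distZero w 0 ∧ HasGerm distOne w 0) :
    Nonempty (Subgroup.closure (insert (juxt 1 pairX.toHomeo, juxt 1 b)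
      (insert (pairX.toHomeo, juxt a 1) (MonoidHom.inl _ (unitInterval ≃o unitInterval) '' W)))
      ≃* F) := by
  set D := insert (juxt 1 pairX.toHomeo, juxt 1 b) (insert (pairX.toHomeo, juxt a 1)
    (MonoidHom.inl _ (unitInterval ≃o unitInterval) '' W)) with hD
  -- The slope exponents at 0 and 1 are `(1, -1)` for the first generator and `(0, -1)` for the
  -- second. Hence `k` and `-k - l` count the occurrences of `a` and `b`, which commute because they
  -- act on different halves.
  have key : ∀ q ∈ Subgroup.closure D, ∃ k l : ℤ, HasGerm distZero q.1 k ∧ HasGerm distOne q.1 l ∧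
      q.2 = juxt (a ^ k) (b ^ (-k - l)) := by
    intro q hq
    induction hq using Subgroup.closure_induction with
    | mem q hq =>
      rcases hq with rfl | rfl | ⟨w, hw, rfl⟩
      · exact ⟨0, -1, (HasGerm.one _).juxt_zero _, pairX_germ_one.juxt_one _, by simp⟩
      · exact ⟨1, -1, pairX_germ_zero, pairX_germ_one, by simp⟩
      · exact ⟨0, 0, (hW w hw).2.1, (hW w hw).2.2, by simp [juxt_one]⟩
    | one => exact ⟨0, 0, HasGerm.one _, HasGerm.one _, by simp [juxt_one]⟩
    | mul p q _ _ hp hq =>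
      obtain ⟨k, l, h1, h2, h3⟩ := hp
      obtain ⟨k', l', h1', h2', h3'⟩ := hq
      refine ⟨k + k', l + l', h1.mul h1', h2.mul h2', ?_⟩
      rw [Prod.snd_mul, h3, h3', juxt_mul, ← zpow_add, ← zpow_add]
      congr 2
      ring
    | inv q _ hq =>
      obtain ⟨k, l, h1, h2, h3⟩ := hq
      refine ⟨-k, -l, h1.inv, h2.inv, ?_⟩
      rw [Prod.snd_inv, h3, juxt_inv, ← zpow_neg, ← zpow_neg]
      congr 2
      ring
  have hinj : Function.Injective ((MonoidHom.fst (unitInterval ≃o unitInterval)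
      (unitInterval ≃o unitInterval)).comp (Subgroup.closure D).subtype) := by
    rw [injective_iff_map_eq_one]
    rintro ⟨q, hq⟩ h
    have h' : q.1 = 1 := h
    obtain ⟨k, l, h1, h2, h3⟩ := key q hq
    rw [h'] at h1 h2
    obtain rfl := h1.eq_zero exists_distZero
    obtain rfl := h2.eq_zero exists_distOne
    refine Subtype.ext (Prod.ext h' ?_)
    rw [h3]
    simp [juxt_one]
  refine ⟨(MonoidHom.ofInjective hinj).trans (MulEquiv.subgroupCongr ?_)⟩
  rw [MonoidHom.range_comp, Subgroup.range_subtype, MonoidHom.map_closure]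
  refine le_antisymm ((Subgroup.closure_le _).2 ?_) ?_
  · rintro _ ⟨q, rfl | rfl | ⟨w, hw, rfl⟩, rfl⟩
    · rw [← genX_eq]
      exact juxt_pairX_mem_genX
    · rw [← genX_eq]
      exact pairX_mem_genX
    · exact (hW w hw).1
  · rw [← genX_eq, genX, Subgroup.closure_le]
    rintro _ (rfl | rfl)
    · exact Subgroup.subset_closure ⟨_, Or.inr (Or.inl rfl), rfl⟩
    · exact Subgroup.subset_closure ⟨_, Or.inl rfl, rfl⟩

namespace ReducedTreePair

/-- A pair which acts as the first generator of Thompson's group on `[0,1/2]`. -/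
def thompsonFst (p : ReducedTreePair) : ReducedTreePair := join pairX p.lower

/-- A pair which acts as the second generator of Thompson's group on `[0,1/2]`. -/
def thompsonSnd (p : ReducedTreePair) : ReducedTreePair := join pairX.upper p.upper

theorem size_pairX : pairX.size = 2 := rfl

theorem size_thompsonFst {p : ReducedTreePair} (hp : 2 ≤ p.size) :
    p.thompsonFst.size = p.size + 4 := by
  have h1 := size_lower p hp
  rw [thompsonFst, size_join _ _ size_pairX.ge (by omega), h1, size_pairX]
  omega

theorem size_thompsonSnd {p : ReducedTreePair} (hp : 2 ≤ p.size) :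
    p.thompsonSnd.size = p.size + 5 := by
  have h1 := size_upper p hp
  have h2 := size_upper pairX size_pairX.ge
  rw [size_pairX] at h2
  rw [thompsonSnd, size_join _ _ (by omega) (by omega), h1, h2]
  omega

theorem thompsonFst_injective : Function.Injective thompsonFst := fun _ _ h =>
  lower_injective (join_inj h).2

theorem thompsonSnd_injective : Function.Injective thompsonSnd := fun _ _ h =>
  upper_injective (join_inj h).2

theorem thompsonSnd_ne_thompsonFst (p q : ReducedTreePair) : p.thompsonSnd ≠ q.thompsonFst :=
  fun h => by
    have h1 := congrArg size (join_inj h).1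
    rw [size_upper pairX size_pairX.ge] at h1
    omega

theorem size_idPair : idPair.size = 1 := rfl

theorem thompsonFst_ne_lower {p : ReducedTreePair} (hp : 2 ≤ p.size) (q : ReducedTreePair) :
    p.thompsonFst ≠ q.lower := fun h => by
  have h1 := congrArg size (join_inj h).2
  rw [size_lower p hp, size_idPair] at h1
  omega

theorem thompsonSnd_ne_lower {p : ReducedTreePair} (hp : 2 ≤ p.size) (q : ReducedTreePair) :
    p.thompsonSnd ≠ q.lower := fun h => by
  have h1 := congrArg size (join_inj h).2
  rw [size_upper p hp, size_idPair] at h1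
  omega

end ReducedTreePair

open ReducedTreePair

theorem setOf_mem_cons {k : ℕ} (a : ReducedTreePair) (t : Sym ReducedTreePair k) :
    {p | p ∈ a ::ₛ t} = insert a {p | p ∈ t} := by
  ext p
  exact Sym.mem_cons

theorem nonempty_generated_equiv_F {k : ℕ} (p q : ReducedTreePair) (s : Sym ReducedTreePair k) :
    Nonempty (generated (q.thompsonSnd ::ₛ p.thompsonFst ::ₛ
      s.map fun w => w.upper.lower.lower) ≃* F) := by
  obtain ⟨e⟩ := nonempty_closure_equiv_F p.toHomeo q.toHomeo
    ((fun w : ReducedTreePair => w.upper.lower.toHomeo) '' {w | w ∈ s}) (by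
      rintro _ ⟨w, -, rfl⟩
      refine ⟨w.upper.lower.toF.2, ?_, ?_⟩
      · simp only [toHomeo_lower, toHomeo_upper]
        exact ((HasGerm.one _).juxt_zero _).juxt_zero _
      · simp only [toHomeo_lower]
        exact (HasGerm.one _).juxt_one _)
  refine ⟨(MulEquiv.subgroupCongr ?_).trans
    ((Subgroup.equivMapOfInjective _ juxtHom juxtHom_injective).symm.trans e)⟩
  rw [MonoidHom.map_closure, generated, setOf_mem_cons, setOf_mem_cons, Set.image_insert_eq,
    Set.image_insert_eq, Set.image_insert_eq, Set.image_insert_eq]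
  have h1 : q.thompsonSnd.toHomeo = juxtHom (juxt 1 pairX.toHomeo, juxt 1 q.toHomeo) := by
    rw [thompsonSnd, toHomeo_join, toHomeo_upper, toHomeo_upper]
    rfl
  have h2 : p.thompsonFst.toHomeo = juxtHom (pairX.toHomeo, juxt p.toHomeo 1) := by
    rw [thompsonFst, toHomeo_join, toHomeo_lower]
    rfl
  rw [h1, h2]
  congr 3
  ext f
  constructor
  · rintro ⟨_, hw', rfl⟩
    obtain ⟨w, hw, rfl⟩ := Sym.mem_map.1 hw'
    exact ⟨_, ⟨_, ⟨w, hw, rfl⟩, rfl⟩, (toHomeo_lower _).symm⟩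
  · rintro ⟨_, ⟨_, ⟨w, hw, rfl⟩, rfl⟩, rfl⟩
    exact ⟨_, Sym.mem_map.2 ⟨w, hw, rfl⟩, toHomeo_lower _⟩

/-- All `k + 2` pairs are free of size `n`. The second generator adds five carets, the other entries
at most four, which gives the shift 5. -/
theorem inMaxSpec_F (k : ℕ) : InMaxSpec (k + 2) F := by
  refine (isLarge_sym k).prod.prod.inMaxSpec 5 (fun b => b.2.thompsonSnd ::ₛ b.1.2.thompsonFst ::ₛ
    b.1.1.map fun w => w.upper.lower.lower) (fun n hn b hb => ⟨?_, ?_⟩) ?_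
  · exact mem_generatingTuples.2 (nonempty_generated_equiv_F _ _ _)
  · obtain ⟨⟨ht, hp⟩, hq⟩ := hb
    have hp : b.1.2.size = n := hp
    have hq : b.2.size = n := hq
    refine cons_mem_maxSphere ((size_thompsonSnd (by omega)).trans (by omega)) ?_
    intro q' hq'
    rcases Sym.mem_cons.1 hq' with rfl | hq'
    · rw [size_thompsonFst (by omega)]
      omega
    · obtain ⟨w, hw, rfl⟩ := Sym.mem_map.1 hq'
      have hw : w.size = n := ht w hw
      have h1 := w.size_upper_le
      have h2 := w.upper.size_lower_le
      have h3 := w.upper.lower.size_lower_le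
      omega
  · rintro n hn ⟨⟨t, p⟩, q⟩ ⟨⟨-, hp⟩, hq⟩ ⟨⟨t', p'⟩, q'⟩ - he
    have hp : p.size = n := hp
    have hq : q.size = n := hq
    obtain ⟨h1, h2⟩ := sym_cons_inj he fun hm => by
      rcases Sym.mem_cons.1 hm with hm | hm
      · exact thompsonSnd_ne_thompsonFst _ _ hm
      · obtain ⟨w, -, hw⟩ := Sym.mem_map.1 hm
        exact thompsonSnd_ne_lower (hn.trans hq.ge) _ hw.symm
    obtain ⟨h3, h4⟩ := sym_cons_inj h2 fun hm => by
      obtain ⟨w, -, hw⟩ := Sym.mem_map.1 hm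
      exact thompsonFst_ne_lower (hn.trans hp.ge) _ hw.symm
    exact Prod.ext (Prod.ext (Sym.map_injective (lower_injective.comp
      (lower_injective.comp upper_injective)) k h4) (thompsonFst_injective h3))
      (thompsonSnd_injective h1)

/-- Two generators of `F` with free parameters are moved to `[1/2,1]`, costing one caret more than
the 5 above; the given tuple moves to `[0,1/2]`. -/
theorem InMaxSpec.prod_F {k : ℕ} {H : Type*} [Group H] (hk : 1 ≤ k) (h : InMaxSpec k H) :
    InMaxSpec (k + 2) (H × F) := by
  refine (h.isLarge hk).prod.prod.inMaxSpec 6 (fun b => b.2.thompsonSnd.upper ::ₛ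
    b.1.2.thompsonFst.upper ::ₛ b.1.1.map lower) (fun n hn b hb => ⟨?_, ?_⟩) ?_
  · obtain ⟨⟨⟨ht, -⟩, -⟩, -⟩ := hb
    rw [mem_generatingTuples] at ht ⊢
    obtain ⟨e⟩ := ht
    -- The empty tuple is used here: the copy of `F` needs no entries beyond its two generators.
    obtain ⟨e'⟩ := nonempty_generated_equiv_F b.1.2 b.2 (Sym.nil : Sym ReducedTreePair 0)
    have hg : generated (b.2.thompsonSnd.upper ::ₛ b.1.2.thompsonFst.upper ::ₛ b.1.1.map lower) =
        (generated (b.2.thompsonSnd ::ₛ b.1.2.thompsonFst ::ₛ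
          (Sym.nil : Sym ReducedTreePair 0).map fun w => w.upper.lower.lower)).map upperHom ⊔
          (generated b.1.1).map lowerHom := by
      rw [generated_cons, generated_cons, generated_cons, generated_cons,
        show Sym.map _ (Sym.nil : Sym ReducedTreePair 0) = Sym.nil from rfl, generated_nil, sup_bot_eq,
        Subgroup.map_sup, MonoidHom.map_zpowers, MonoidHom.map_zpowers, sup_assoc,
        generated_map _ _ lowerHom toHomeo_lower, toHomeo_upper, toHomeo_upper]
      rfl
    exact ⟨(MulEquiv.subgroupCongr hg).trans ((supMapEquivProd _ _).trans (e.prodCongr e'))⟩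
  · obtain ⟨⟨⟨-, ht⟩, hp⟩, hq⟩ := hb
    have hp : b.1.2.size = n := hp
    have hq : b.2.size = n := hq
    have h1 := size_thompsonFst (hn.trans hp.ge)
    have h2 := size_thompsonSnd (hn.trans hq.ge)
    refine cons_mem_maxSphere ((size_upper _ (by omega)).trans (by omega)) ?_
    intro q' hq'
    rcases Sym.mem_cons.1 hq' with rfl | hq'
    · rw [size_upper _ (by omega)]
      omega
    · obtain ⟨w, hw, rfl⟩ := Sym.mem_map.1 hq'
      have hw : w.size ≤ n := ht.1 w hw
      have h3 := w.size_lower_le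
      omega
  · rintro n hn ⟨⟨t, p⟩, q⟩ ⟨⟨-, hp⟩, hq⟩ ⟨⟨t', p'⟩, q'⟩ - he
    have hp : p.size = n := hp
    have hq : q.size = n := hq
    have s1 := size_thompsonFst (hn.trans hp.ge)
    have s2 := size_thompsonSnd (hn.trans hq.ge)
    obtain ⟨h1, h2⟩ := sym_cons_inj he fun hm => by
      rcases Sym.mem_cons.1 hm with hm | hm
      · exact thompsonSnd_ne_thompsonFst _ _ (upper_injective hm)
      · obtain ⟨w, -, hw⟩ := Sym.mem_map.1 hm
        exact upper_ne_lower (by simp only; omega) _ hw.symm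
    obtain ⟨h3, h4⟩ := sym_cons_inj h2 fun hm => by
      obtain ⟨w, -, hw⟩ := Sym.mem_map.1 hm
      exact upper_ne_lower (by simp only; omega) _ hw.symm
    exact Prod.ext (Prod.ext (Sym.map_injective lower_injective k h4)
      (thompsonFst_injective (upper_injective h3))) (thompsonSnd_injective (upper_injective h1))


/-! ### Powers of Thompson's group and of the integers -/

/-- Splitting off the first factor of a finite power of a group. -/
def powSuccEquiv (n : ℕ) (G : Type*) [Group G] : (Fin n → G) × G ≃* (Fin (n + 1) → G) where
  toFun q := Fin.cons q.2 q.1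
  invFun f := (Fin.tail f, f 0)
  left_inv q := by simp
  right_inv f := by simp
  map_mul' p q := by
    funext i
    refine Fin.cases ?_ (fun i => ?_) i <;> simp

theorem inMaxSpec_pow_F (n : ℕ) : ∀ k, 2 * (n + 1) ≤ k → InMaxSpec k (Fin (n + 1) → F) := by
  induction n with
  | zero =>
    intro k hk
    obtain ⟨k, rfl⟩ := Nat.exists_eq_add_of_le' hk
    exact (inMaxSpec_F k).congr (MulEquiv.funUnique (Fin 1) F).symm
  | succ n ih =>
    intro k hk
    obtain ⟨k, rfl⟩ := Nat.exists_eq_add_of_le' (show 2 ≤ k by omega)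
    exact ((ih k (by omega)).prod_F (by omega)).congr (powSuccEquiv (n + 1) F)

theorem inMaxSpec_pow_F_prod_int (n m : ℕ) : ∀ k, 2 * (n + 1) + m ≤ k →
    InMaxSpec k ((Fin (n + 1) → F) × (Fin m → Multiplicative ℤ)) := by
  induction m with
  | zero =>
    intro k hk
    exact (inMaxSpec_pow_F n k hk).congr MulEquiv.prodUnique.symm
  | succ m ih =>
    intro k hk
    obtain ⟨k, rfl⟩ := Nat.exists_eq_add_of_le' (show 1 ≤ k by omega)
    exact ((ih k (by omega)).prod_int (by omega)).congr
      (MulEquiv.prodAssoc.trans ((MulEquiv.refl _).prodCongr (powSuccEquiv m _)))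

theorem inMaxSpec_int : InMaxSpec 1 (Multiplicative ℤ) := by
  refine (isLarge_sym 1).inMaxSpec 0 id (fun n hn t ht => ?_) fun _ _ => Function.injective_id.injOn
  have ht : ∀ p ∈ t, p.size = n := ht
  obtain ⟨a, s, rfl⟩ := t.exists_eq_cons_of_succ
  have ha := ht a (Sym.mem_cons_self _ _)
  rw [s.eq_nil_of_card_zero] at ht ⊢
  refine ⟨mem_generatingTuples.2 ?_, cons_mem_maxSphere ha fun p hp => by simp at hp⟩
  obtain ⟨e⟩ := nonempty_zpowers_equiv (ReducedTreePair.toHomeo_ne_one (hn.trans ha.ge))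
  exact ⟨(MulEquiv.subgroupCongr (by
    rw [id, generated_cons, generated_nil, sup_bot_eq])).trans e⟩

theorem inMaxSpec_iteratedWreathZ (j : ℕ) : InMaxSpec (j + 1) (iteratedWreathZ j) := by
  induction j with
  | zero => exact inMaxSpec_int
  | succ j ih => exact ih.wreath_int (by omega)

end ThompsonSpectrum

theorem mainTheorem6 :
    (∀ (k : ℕ) (H : Type*) [Group H], 1 ≤ k → ThompsonSpectrum.InMaxSpec k H →
      ThompsonSpectrum.InMaxSpec (k + 1) (H × Multiplicative ℤ) ∧
      ThompsonSpectrum.InMaxSpec (k + 1) (ThompsonSpectrum.WreathZ H)) ∧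
    (∀ j : ℕ, ThompsonSpectrum.InMaxSpec (j + 1) (ThompsonSpectrum.iteratedWreathZ j)) ∧
    (∀ (l : ℕ) (H : Type*) [Group H], 1 ≤ l →
      (∀ k, l ≤ k → ThompsonSpectrum.InMaxSpec k H) →
      ∀ k, l + 1 ≤ k →
        ThompsonSpectrum.InMaxSpec k (H × Multiplicative ℤ) ∧
        ThompsonSpectrum.InMaxSpec k (ThompsonSpectrum.WreathZ H)) ∧
    (∀ n m k : ℕ, 1 ≤ n → 2 * n + m ≤ k →
      ThompsonSpectrum.InMaxSpec k ((Fin n → ThompsonSpectrum.F) × (Fin m → Multiplicative ℤ))) ∧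
    (∀ n k : ℕ, 1 ≤ n → 2 * n + 1 ≤ k →
      ThompsonSpectrum.InMaxSpec k (ThompsonSpectrum.WreathZ (Fin n → ThompsonSpectrum.F))) := by

  refine ⟨fun k H _ hk h => ⟨h.prod_int hk, h.wreath_int hk⟩,
    ThompsonSpectrum.inMaxSpec_iteratedWreathZ, fun l H _ hl h k hk => ?_,
    fun n m k hn hk => ?_, fun n k hn hk => ?_⟩
  · obtain ⟨k, rfl⟩ := Nat.exists_eq_add_of_le' (show 1 ≤ k by omega)
    have h' := h k (by omega)
    exact ⟨h'.prod_int (by omega), h'.wreath_int (by omega)⟩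
  · obtain ⟨n, rfl⟩ := Nat.exists_eq_add_of_le' hn
    exact ThompsonSpectrum.inMaxSpec_pow_F_prod_int n m k hk
  · obtain ⟨n, rfl⟩ := Nat.exists_eq_add_of_le' hn
    obtain ⟨k, rfl⟩ := Nat.exists_eq_add_of_le' (show 1 ≤ k by omega)
    exact (ThompsonSpectrum.inMaxSpec_pow_F n k (by omega)).wreath_int (by omega)
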